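/- All graphs are finite, simple and undirected. A graph is \emph{matching covered} if it is connected and each of its edges lies in a perfect matching. For a set $X$ of vertices of $G$, $\partial(X)$ is the set of edges with exactly one end in $X$, and its \emph{matching porosity} is the maximum of $|M\cap\partial(X)|$ over all perfect matchings $M$ of $G$. A \emph{perfect matching decomposition} of $G$ is a pair $(T,\delta)$, where $T$ is a tree in which every vertex has degree $1$ or $3$ and $\delta$ is a bijection from the leaves of $T$ to $V(G)$. Deleting an edge $e$ of $T$ splits the leaves into two classes, whose images under $\delta$ are the two shores of the cut induced by $e$. The \emph{width} of $(T,\delta)$ is the maximum matching porosity of a cut induced by an edge of $T$. For a perfect matching $M$ of $G$, a set $S\subseteq V(G)$ is \emph{$M$-conformal} if the edges of $M$ inside $S$ form a perfect matching of $G[S]$ and the edges of $M$ inside $V(G)\setminus S$ form a perfect matching of $G-S$. The \emph{$M$-perfect matching width} $M\text{-}\mathrm{pmw}(G)$ is the smallest width of a perfect matching decomposition $(T,\delta)$ of $G$ such that, for every edge of $T$ neither end of which is a leaf, both shores of the induced cut are $M$-conformal. A cut $\partial(Z)$ is \emph{tight} if $|M\cap\partial(Z)|=1$ for every perfect matching $M$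 of $G$, and it is \emph{nontrivial} if neither $Z$ nor $V(G)\setminus Z$ consists of exactly one vertex. Contracting the shore $Z$ of a nontrivial tight cut means identifying $Z$ to a single vertex and deleting the resulting loops and parallel edges. A \emph{brace} is a bipartite matching covered graph without nontrivial tight cuts. The \emph{braces of} a bipartite matching covered graph $G$ are the braces that are obtained from $G$ by a (possibly empty) sequence of contractions of shores of nontrivial tight cuts. \textbf{Theorem.} Let $G$ be a bipartite matching covered graph that has a perfect matching. Then the following statements are equivalent. \begin{enumerate} \item $M\text{-}\mathrm{pmw}(G)=2$ for some perfect matching $M$ of $G$. \item $M\text{-}\mathrm{pmw}(G)=2$ for all perfect matchings $M$ of $G$. \item Every brace of $G$ is isomorphic to $C_4$ or to $K_{3,3}$. \end{enumerate} -/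

import Mathlib

universe u

namespace PMWidth

open SimpleGraph

section Matchings

variable {V : Type u}

/-- A graph is matching covered if it is connected and each of its edges lies in a perfect
matching. -/
def IsMatchingCovered (G : SimpleGraph V) : Prop :=
  G.Connected ∧ ∀ e ∈ G.edgeSet, ∃ M : G.Subgraph, M.IsPerfectMatching ∧ e ∈ M.edgeSet

/-- The cut at `X`: all edges joining a vertex of `X` to a vertex outside `X`. -/
def cut (G : SimpleGraph V) (X : Set V) : Set (Sym2 V) :=
  {e | ∃ x ∈ X, ∃ y ∉ X, G.Adj x y ∧ e = s(x, y)}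

/-- The matching porosity of the cut at `X`: the maximum over all perfect matchings `M` of the
number of edges of `M` in the cut (the set is finite and bounded when the graph is finite). -/
noncomputable def porosity (G : SimpleGraph V) (X : Set V) : ℕ :=
  sSup {k | ∃ M : G.Subgraph, M.IsPerfectMatching ∧ k = (M.edgeSet ∩ cut G X).ncard}

/-- `S` is `M`-conformal: the restrictions of `M` to `G[S]` and to `G - S` are perfect matchings
of `G[S]` and of `G - S`. -/
def IsConformal {G : SimpleGraph V} (M : G.Subgraph) (S : Set V) : Prop :=
  (M.comap (Embedding.induce S : G.induce S ↪g G).toHom).IsPerfectMatching ∧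
    (M.comap (Embedding.induce Sᶜ : G.induce Sᶜ ↪g G).toHom).IsPerfectMatching

end Matchings

section Decompositions

/-- A vertex is a leaf if it has exactly one neighbour. -/
def IsLeaf {W : Type*} (T : SimpleGraph W) (t : W) : Prop :=
  (T.neighborSet t).ncard = 1

/-- A perfect matching decomposition of a graph with vertex set `V`: a finite cubic tree (every
vertex has degree 1 or 3) and a bijection from its leaves to `V`. -/
structure PMDecomposition (V : Type u) where
  Node : Type
  finite_node : Finite Node
  tree : SimpleGraph Node
  isTree : tree.IsTree
  cubic : ∀ t, (tree.neighborSet t).ncard = 1 ∨ (tree.neighborSet t).ncard = 3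
  leafEquiv : {t : Node // IsLeaf tree t} ≃ V

namespace PMDecomposition

variable {V : Type u}

/-- The vertices mapped to by the leaves in the component of `t₁` in the tree minus the edge
`t₁t₂`. -/
def shore (D : PMDecomposition V) (t₁ t₂ : D.Node) : Set V :=
  {v | (D.tree.deleteEdges {s(t₁, t₂)}).Reachable t₁ (D.leafEquiv.symm v : D.Node)}

/-- The width of a decomposition: the maximum porosity of a cut induced by an edge of the tree. -/
noncomputable def width (D : PMDecomposition V) (G : SimpleGraph V) : ℕ :=
  sSup {k | ∃ t₁ t₂, D.tree.Adj t₁ t₂ ∧ k = porosity G (D.shore t₁ t₂)}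

/-- The decomposition is an `M`-decomposition: for every inner edge of the tree (no endpoint is a
leaf), both shores of the induced cut are `M`-conformal. -/
def IsMDecomposition (D : PMDecomposition V) {G : SimpleGraph V} (M : G.Subgraph) : Prop :=
  ∀ t₁ t₂, D.tree.Adj t₁ t₂ → ¬ IsLeaf D.tree t₁ → ¬ IsLeaf D.tree t₂ →
    IsConformal M (D.shore t₁ t₂) ∧ IsConformal M (D.shore t₂ t₁)

end PMDecomposition

/-- The `M`-perfect matching width: the smallest width of an `M`-decomposition. -/
noncomputable def mpmw {V : Type u} (G : SimpleGraph V) (M : G.Subgraph) : ℕ :=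
  sInf {k | ∃ D : PMDecomposition V, D.IsMDecomposition M ∧ k = D.width G}

end Decompositions

section TightCuts

/-- The cut at `Z` is tight and neither of its shores is a single vertex. -/
def IsNontrivialTightCut {V : Type u} (G : SimpleGraph V) (Z : Set V) : Prop :=
  (∀ M : G.Subgraph, M.IsPerfectMatching → (M.edgeSet ∩ cut G Z).ncard = 1) ∧
    Z.ncard ≠ 1 ∧ Zᶜ.ncard ≠ 1

/-- The simple graph obtained by identifying `Z` into one vertex `none`, deleting loops and
parallel edges. -/
def contract {V : Type u} (G : SimpleGraph V) (Z : Set V) : SimpleGraph (Option {v // v ∉ Z}) where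
  Adj
    | some x, some y => G.Adj x y
    | none, some y => ∃ z ∈ Z, G.Adj z y
    | some x, none => ∃ z ∈ Z, G.Adj z x
    | none, none => False
  symm := ⟨by
    rintro (_ | x) (_ | y) h
    · exact h
    · exact h
    · exact h
    · exact G.adj_symm h⟩
  loopless := ⟨by
    rintro (_ | x) h
    · exact h
    · exact G.irrefl h⟩

/-- `H` occurs in some run of the tight cut decomposition procedure started from `G`: it arises
from `G` by a (possibly empty) sequence of contractions of shores of nontrivial tight cuts.
(Contracting the other shore of the cut at `Z` is the step for `Zᶜ`.) -/
inductive OccursInTightCutDecomposition {V : Type u} (G : SimpleGraph V) :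
    ∀ {W : Type u}, SimpleGraph W → Prop
  | start : OccursInTightCutDecomposition G G
  | contract {W : Type u} {H : SimpleGraph W} (Z : Set W) :
      OccursInTightCutDecomposition G H → IsNontrivialTightCut H Z →
        OccursInTightCutDecomposition G (PMWidth.contract H Z)

/-- A brace is a bipartite matching covered graph without nontrivial tight cuts. -/
def IsBrace {V : Type u} (G : SimpleGraph V) : Prop :=
  G.IsBipartite ∧ IsMatchingCovered G ∧ ∀ Z : Set V, ¬ IsNontrivialTightCut G Z

/-- `H` is a brace of `G`: a brace produced by the tight cut decomposition procedure. -/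
def IsBraceOf {V W : Type u} (H : SimpleGraph W) (G : SimpleGraph V) : Prop :=
  OccursInTightCutDecomposition G H ∧ IsBrace H

end TightCuts

end PMWidth

/-! A perfect matching is treated as a fixed-point-free involution `m`, so that conformal sets are
those closed under `m` and porosity counts the vertices of a set whose partner lies outside it. In a
bipartite graph the colour imbalance of a set equals the difference between the numbers of matching
edges leaving it from the two classes, whichever perfect matching is taken
(`IsSide.ncard_add_crossingFrom`).

From width two to small braces: a cubic tree has an edge that splits a large set in a balanced way,
so an `M`-decomposition of width two yields `SplitsConformal`: every conformal set of at least eight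
vertices is cut by a conformal set of porosity at most two into parts of at least four vertices.
Unlike the decomposition tree, this property passes easily to tight cut contractions
(`SplitsConformal.contract`). A brace with at least eight vertices cannot have it. Without
nontrivial tight cuts, a conformal set with at least four vertices on each side is left by two
disjoint edges from the same colour class; two-extendability puts both in a perfect matching, and
balance forces two further crossings, hence porosity at least four. The braces thus have four or six
vertices, and such braces are complete bipartite.

From small braces to width two: the inductive object is a binary hierarchy of conformal sets of
porosity at most two on the complement of a matching edge (`HasHierarchy`). In a brace of order four
or six it exists because at most two other matching edges remain. Across a tight cut, met by `m` in
the edge from `a` to `m a`, the hierarchies of the two contractions join to one on the complement of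
`{a, m a}`; rerooting moves the omitted edge anywhere (`hasHierarchy_of_forall_brace`). A hierarchy
is then unfolded into a cubic tree. Width below two is impossible on at least four vertices by
connectedness and parity. -/

namespace PMWidth

open SimpleGraph

/-! ### Perfect matchings as involutions; parity and colour balance of cuts -/

section Involutions

variable {V : Type u}

/-- A perfect matching of `G`, given by the function sending each vertex to its partner. -/
def IsPM (G : SimpleGraph V) (m : V → V) : Prop :=
  ∀ v, G.Adj v (m v) ∧ m (m v) = v

/-- The number of matching edges leaving `X`. -/
noncomputable def crossing (m : V → V) (X : Set V) : ℕ :=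
  {v | v ∈ X ∧ m v ∉ X}.ncard

/-- `X` is a union of matching edges. -/
def Closed (m : V → V) (X : Set V) : Prop :=
  ∀ v, m v ∈ X ↔ v ∈ X

variable {G : SimpleGraph V}

theorem IsPM.injective {m : V → V} (hm : IsPM G m) : Function.Injective m :=
  Function.LeftInverse.injective (g := m) fun v => (hm v).2

theorem IsPM.eq_iff {m : V → V} (hm : IsPM G m) {v w : V} : m v = w ↔ m w = v :=
  ⟨fun h => h ▸ (hm v).2, fun h => h ▸ (hm w).2⟩

theorem exists_isPM_of_isPerfectMatching {M : G.Subgraph} (hM : M.IsPerfectMatching) :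
    ∃ m, IsPM G m ∧ ∀ v w, M.Adj v w ↔ m v = w := by
  rw [Subgraph.isPerfectMatching_iff] at hM
  choose m h1 h2 using hM
  have key : ∀ v w, M.Adj v w ↔ m v = w := fun v w =>
    ⟨fun h => (h2 v w h).symm, fun h => h ▸ h1 v⟩
  exact ⟨m, fun v => ⟨(h1 v).adj_sub, (key _ _).1 (h1 v).symm⟩, key⟩

theorem exists_isPerfectMatching_of_isPM {m : V → V} (hm : IsPM G m) :
    ∃ M : G.Subgraph, M.IsPerfectMatching ∧ ∀ v w, M.Adj v w ↔ m v = w := by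
  refine ⟨{ verts := Set.univ, Adj := fun v w => m v = w, adj_sub := ?_, edge_vert := ?_,
            symm := ⟨?_⟩ }, ?_, fun v w => Iff.rfl⟩
  · rintro v w rfl
    exact (hm v).1
  · intros
    trivial
  · rintro v w rfl
    exact (hm v).2
  · rw [Subgraph.isPerfectMatching_iff]
    exact fun v => ⟨m v, rfl, fun w (h : m v = w) => h.symm⟩

theorem ncard_edgeSet_inter_cut {M : G.Subgraph} {m : V → V} (hm : IsPM G m)
    (h : ∀ v w, M.Adj v w ↔ m v = w) (X : Set V) :
    (M.edgeSet ∩ cut G X).ncard = crossing m X := by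
  have : M.edgeSet ∩ cut G X = (fun v => s(v, m v)) '' {v | v ∈ X ∧ m v ∉ X} := by
    ext e
    constructor
    · rintro ⟨he, x, hx, y, hy, -, rfl⟩
      rw [Subgraph.mem_edgeSet, h] at he
      subst he
      exact ⟨x, ⟨hx, hy⟩, rfl⟩
    · rintro ⟨x, ⟨hx, hy⟩, rfl⟩
      exact ⟨by rw [Subgraph.mem_edgeSet, h], x, hx, m x, hy, (hm x).1, rfl⟩
  -- A crossing edge has only one end in `X`, so it is counted at exactly one vertex.
  rw [this, Set.InjOn.ncard_image, crossing]
  rintro v ⟨hv, -⟩ w ⟨-, hw⟩ hvw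
  rcases Sym2.eq_iff.1 hvw with ⟨h, -⟩ | ⟨h, -⟩
  · exact h
  · exact absurd (h ▸ hv) hw

theorem crossing_le_card [Finite V] (m : V → V) (X : Set V) : crossing m X ≤ X.ncard :=
  Set.ncard_le_ncard (fun _ h => h.1) (Set.toFinite _)

theorem crossing_compl [Finite V] {m : V → V} (hm : IsPM G m) (X : Set V) :
    crossing m Xᶜ = crossing m X := by
  unfold crossing
  have : {v | v ∈ Xᶜ ∧ m v ∉ Xᶜ} = m '' {v | v ∈ X ∧ m v ∉ X} := by
    ext v
    constructor
    · rintro ⟨h1, h2⟩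
      exact ⟨m v, ⟨by simpa using h2, by simpa [(hm v).2] using h1⟩, (hm v).2⟩
    · rintro ⟨w, ⟨h1, h2⟩, rfl⟩
      exact ⟨h2, by simpa [(hm w).2] using h1⟩
  rw [this, Set.ncard_image_of_injective _ hm.injective]

theorem porosity_le_iff [Finite V] {X : Set V} {k : ℕ} :
    porosity G X ≤ k ↔ ∀ m, IsPM G m → crossing m X ≤ k := by
  constructor
  · intro h m hm
    obtain ⟨M, hM, hMm⟩ := exists_isPerfectMatching_of_isPM hm
    rw [← ncard_edgeSet_inter_cut hm hMm X]
    unfold porosity at h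
    refine le_trans ?_ h
    -- The bound by `X.ncard` makes the supremum in `ℕ` genuine; an unbounded set would have the
    -- default value `0`.
    refine le_csSup ⟨X.ncard, ?_⟩ ⟨M, hM, rfl⟩
    rintro _ ⟨M', hM', rfl⟩
    obtain ⟨m', hm', h'⟩ := exists_isPM_of_isPerfectMatching hM'
    rw [ncard_edgeSet_inter_cut hm' h']
    exact crossing_le_card _ _
  · intro h
    refine csSup_le' ?_
    rintro _ ⟨M', hM', rfl⟩
    obtain ⟨m', hm', h'⟩ := exists_isPM_of_isPerfectMatching hM'
    rw [ncard_edgeSet_inter_cut hm' h']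
    exact h _ hm'

theorem isPerfectMatching_comap_induce_iff {M : G.Subgraph} {m : V → V}
    (h : ∀ v w, M.Adj v w ↔ m v = w) (hm : IsPM G m) (S : Set V) :
    (M.comap (Embedding.induce S : G.induce S ↪g G).toHom).IsPerfectMatching ↔
      ∀ v ∈ S, m v ∈ S := by
  rw [Subgraph.isPerfectMatching_iff]
  constructor
  · intro H v hv
    obtain ⟨w, hw, -⟩ := H ⟨v, hv⟩
    have : m v = w := (h _ _).1 hw.2
    exact this ▸ w.2
  · intro H v
    refine ⟨⟨m v, H v v.2⟩, ⟨(hm v).1, (h _ _).2 rfl⟩, ?_⟩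
    rintro w ⟨-, hw⟩
    exact Subtype.ext ((h _ _).1 hw).symm

theorem isConformal_iff {M : G.Subgraph} {m : V → V}
    (h : ∀ v w, M.Adj v w ↔ m v = w) (hm : IsPM G m) (S : Set V) :
    IsConformal M S ↔ Closed m S := by
  unfold IsConformal
  rw [isPerfectMatching_comap_induce_iff h hm, isPerfectMatching_comap_induce_iff h hm]
  constructor
  · rintro ⟨h1, h2⟩ v
    exact ⟨fun hv => by_contra fun hv' => h2 v hv' hv, h1 v⟩
  · intro H
    exact ⟨fun v hv => (H v).2 hv, fun v hv hv' => hv ((H v).1 hv')⟩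

theorem isNontrivialTightCut_iff {Z : Set V} :
    IsNontrivialTightCut G Z ↔
      (∀ m, IsPM G m → crossing m Z = 1) ∧ Z.ncard ≠ 1 ∧ Zᶜ.ncard ≠ 1 := by
  refine and_congr ⟨fun h m hm => ?_, fun h M hM => ?_⟩ Iff.rfl
  · obtain ⟨M, hM, hMm⟩ := exists_isPerfectMatching_of_isPM hm
    rw [← ncard_edgeSet_inter_cut hm hMm]
    exact h M hM
  · obtain ⟨m, hm, hMm⟩ := exists_isPM_of_isPerfectMatching hM
    rw [ncard_edgeSet_inter_cut hm hMm]
    exact h m hm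

theorem IsNontrivialTightCut.compl [Finite V] {Z : Set V} (h : IsNontrivialTightCut G Z) :
    IsNontrivialTightCut G Zᶜ := by
  rw [isNontrivialTightCut_iff] at *
  exact ⟨fun m hm => (crossing_compl hm Z).trans (h.1 m hm), h.2.2, by rw [compl_compl]; exact h.2.1⟩

theorem isMatchingCovered_iff :
    IsMatchingCovered G ↔
      G.Connected ∧ ∀ v w, G.Adj v w → ∃ m, IsPM G m ∧ m v = w := by
  refine and_congr Iff.rfl ⟨fun h v w hvw => ?_, fun h e he => ?_⟩
  · obtain ⟨M, hM, he⟩ := h s(v, w) hvw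
    obtain ⟨m, hm, hMm⟩ := exists_isPM_of_isPerfectMatching hM
    exact ⟨m, hm, (hMm _ _).1 he⟩
  · induction e with | h v w
    obtain ⟨m, hm, hvw⟩ := h v w he
    obtain ⟨M, hM, hMm⟩ := exists_isPerfectMatching_of_isPM hm
    exact ⟨M, hM, (hMm _ _).2 hvw⟩

/-- The involution has no fixed point on `S`, so summing `1` over `S` in `ZMod 2` cancels in pairs.
-/
theorem even_ncard_of_mapsTo [Finite V] {m : V → V} (hm : IsPM G m) {S : Set V}
    (hS : ∀ v ∈ S, m v ∈ S) : Even S.ncard := by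
  classical
  have := Fintype.ofFinite V
  rw [Set.ncard_eq_toFinset_card', ← ZMod.natCast_eq_zero_iff_even, Finset.cast_card]
  refine Finset.sum_involution (fun v _ => m v) ?_ ?_ ?_ ?_
  · intros
    decide
  · intro v _ _ h
    exact (hm v).1.ne h.symm
  · intro v hv
    simpa using hS v (by simpa using hv)
  · intro v _
    exact (hm v).2

theorem ncard_eq_add_crossing [Finite V] (m : V → V) (X : Set V) :
    X.ncard = {v | v ∈ X ∧ m v ∈ X}.ncard + crossing m X := by
  rw [crossing, ← Set.ncard_union_eq (Set.disjoint_left.2 fun v h1 h2 => h2.2 h1.2)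
    (Set.toFinite _) (Set.toFinite _)]
  congr 1
  ext v
  by_cases h : m v ∈ X <;> simp [h]

theorem even_crossing_iff [Finite V] {m : V → V} (hm : IsPM G m) (X : Set V) :
    Even (crossing m X) ↔ Even X.ncard := by
  have h : Even {v | v ∈ X ∧ m v ∈ X}.ncard :=
    even_ncard_of_mapsTo hm fun v hv => ⟨hv.2, by rw [(hm v).2]; exact hv.1⟩
  rw [ncard_eq_add_crossing m X, Nat.even_add]
  simp [h]

theorem Closed.even_ncard [Finite V] {m : V → V} (hm : IsPM G m) {X : Set V} (h : Closed m X) :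
    Even X.ncard :=
  even_ncard_of_mapsTo hm fun v hv => (h v).2 hv

theorem Closed.inter {m : V → V} {X Y : Set V} (hX : Closed m X) (hY : Closed m Y) :
    Closed m (X ∩ Y) := fun v => and_congr (hX v) (hY v)

theorem Closed.union {m : V → V} {X Y : Set V} (hX : Closed m X) (hY : Closed m Y) :
    Closed m (X ∪ Y) := fun v => or_congr (hX v) (hY v)

theorem Closed.compl {m : V → V} {X : Set V} (hX : Closed m X) : Closed m Xᶜ :=
  fun v => not_congr (hX v)

theorem crossing_pair_le [Finite V] (m : V → V) (v w : V) : crossing m {v, w} ≤ 2 :=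
  (crossing_le_card _ _).trans ((Set.ncard_insert_le _ _).trans (by simp))

/-- `A` is one colour class of a bipartition of `G`. -/
def IsSide (G : SimpleGraph V) (A : Set V) : Prop :=
  ∀ v w, G.Adj v w → (w ∈ A ↔ v ∉ A)

theorem isBipartite_iff_exists_isSide : G.IsBipartite ↔ ∃ A, IsSide G A := by
  classical
  constructor
  · rintro ⟨c⟩
    refine ⟨{v | c v = 0}, fun v w h => ?_⟩
    have := c.valid h
    simp only [Set.mem_ofPred_eq]
    omega
  · rintro ⟨A, hA⟩
    refine ⟨Coloring.mk (fun v => if v ∈ A then 0 else 1) ?_⟩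
    intro v w h
    have := hA v w h
    by_cases hv : v ∈ A <;> simp_all

theorem IsSide.compl {A : Set V} (hA : IsSide G A) : IsSide G Aᶜ :=
  fun v w h => by
    have := hA v w h
    simp only [Set.mem_compl_iff]
    tauto

theorem IsSide.partner_mem_iff {A : Set V} (hA : IsSide G A) {m : V → V} (hm : IsPM G m) (v : V) :
    m v ∈ A ↔ v ∉ A := hA v (m v) (hm v).1

/-- The matching edges leaving `X` from the colour class `A`. -/
noncomputable def crossingFrom (A : Set V) (m : V → V) (X : Set V) : ℕ :=
  {v | v ∈ X ∩ A ∧ m v ∉ X}.ncard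

theorem crossing_eq_add [Finite V] (A : Set V) (m : V → V) (X : Set V) :
    crossing m X = crossingFrom A m X + crossingFrom Aᶜ m X := by
  rw [crossing, crossingFrom, crossingFrom,
    ← Set.ncard_union_eq (Set.disjoint_left.2 fun v h1 h2 => h2.1.2 h1.1.2)
    (Set.toFinite _) (Set.toFinite _)]
  congr 1
  ext v
  by_cases h : v ∈ A <;> simp [h]

theorem ncard_inter_eq_add_crossingFrom [Finite V] (A : Set V) (m : V → V) (X : Set V) :
    (X ∩ A).ncard = {v | v ∈ X ∩ A ∧ m v ∈ X}.ncard + crossingFrom A m X := by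
  rw [crossingFrom, ← Set.ncard_union_eq (Set.disjoint_left.2 fun v h1 h2 => h2.2 h1.2)
    (Set.toFinite _) (Set.toFinite _)]
  congr 1
  ext v
  by_cases h : m v ∈ X <;> simp [h]

/-- The matching edges inside `X` pair equally many vertices of both classes, so the imbalance of
`X` is carried by the crossing edges alone. Since the imbalance does not depend on `m`, this
controls all perfect matchings at once. -/
theorem IsSide.ncard_add_crossingFrom [Finite V] {A : Set V} (hA : IsSide G A) {m : V → V}
    (hm : IsPM G m) (X : Set V) :
    (X ∩ A).ncard + crossingFrom Aᶜ m X = (X ∩ Aᶜ).ncard + crossingFrom A m X := by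
  rw [ncard_inter_eq_add_crossingFrom A m X, ncard_inter_eq_add_crossingFrom Aᶜ m X]
  have : {v | v ∈ X ∩ Aᶜ ∧ m v ∈ X} = m '' {v | v ∈ X ∩ A ∧ m v ∈ X} := by
    ext v
    constructor
    · rintro ⟨⟨h1, h2⟩, h3⟩
      exact ⟨m v, ⟨⟨h3, (hA.partner_mem_iff hm v).2 h2⟩, by rwa [(hm v).2]⟩, (hm v).2⟩
    · rintro ⟨w, ⟨⟨h1, h2⟩, h3⟩, rfl⟩
      exact ⟨⟨h3, fun h => (hA.partner_mem_iff hm w).1 h h2⟩, by rwa [(hm w).2]⟩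
  rw [this, Set.ncard_image_of_injective _ hm.injective]
  omega

end Involutions

/-! ### Tight cut contractions and the transfer of perfect matchings -/

section Contractions

variable {V : Type u} {G : SimpleGraph V}

theorem exists_crossing_of_crossing_eq_one {m : V → V} {Z : Set V} (h : crossing m Z = 1) :
    ∃ a ∈ Z, m a ∉ Z ∧ ∀ v ∈ Z, m v ∉ Z → v = a := by
  obtain ⟨a, ha⟩ := Set.ncard_eq_one.1 h
  have hmem : ∀ v, (v ∈ Z ∧ m v ∉ Z) ↔ v = a := fun v => Set.ext_iff.1 ha v
  have := (hmem a).2 rfl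
  exact ⟨a, this.1, this.2, fun v h1 h2 => (hmem v).1 ⟨h1, h2⟩⟩

open Classical in
/-- The projection onto the vertices of the contraction. -/
noncomputable def toContract (Z : Set V) (v : V) : Option {v // v ∉ Z} :=
  if h : v ∈ Z then none else some ⟨v, h⟩

/-- The section of `toContract` sending the contracted vertex to `a`. -/
def ofContract {Z : Set V} (a : V) : Option {v // v ∉ Z} → V
  | none => a
  | some v => v

theorem toContract_of_mem {Z : Set V} {v : V} (h : v ∈ Z) : toContract Z v = none := dif_pos h

theorem toContract_of_notMem {Z : Set V} {v : V} (h : v ∉ Z) :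
    toContract Z v = some ⟨v, h⟩ := dif_neg h

@[simp]
theorem toContract_coe {Z : Set V} (v : {v // v ∉ Z}) : toContract Z v = some v :=
  toContract_of_notMem v.2

theorem toContract_eq_some_iff {Z : Set V} {v : V} {w : {v // v ∉ Z}} :
    toContract Z v = some w ↔ v = w := by
  constructor
  · intro h
    by_cases hv : v ∈ Z
    · simp [toContract_of_mem hv] at h
    · rw [toContract_of_notMem hv, Option.some_inj] at h
      exact congrArg Subtype.val h
  · rintro rfl
    exact toContract_coe w

theorem ofContract_injective {Z : Set V} {a : V} (ha : a ∈ Z) :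
    Function.Injective (ofContract (Z := Z) a) := by
  rintro (_ | v) (_ | w) h
  · rfl
  · exact absurd ((show a = w from h) ▸ ha) w.2
  · exact absurd ((show (v : V) = a from h) ▸ ha) v.2
  · exact congrArg some (Subtype.ext h)

theorem contract_adj_toContract {Z : Set V} {v w : V} (h : G.Adj v w)
    (hZ : ¬ (v ∈ Z ∧ w ∈ Z)) : (contract G Z).Adj (toContract Z v) (toContract Z w) := by
  by_cases hv : v ∈ Z <;> by_cases hw : w ∈ Z
  · exact absurd ⟨hv, hw⟩ hZ
  · rw [toContract_of_mem hv, toContract_of_notMem hw]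
    exact ⟨v, hv, h⟩
  · rw [toContract_of_mem hw, toContract_of_notMem hv]
    exact ⟨w, hw, h.symm⟩
  · rw [toContract_of_notMem hv, toContract_of_notMem hw]
    exact h

theorem exists_adj_of_contract_adj {Z : Set V} {x y : Option {v // v ∉ Z}}
    (h : (contract G Z).Adj x y) :
    ∃ v w, G.Adj v w ∧ toContract Z v = x ∧ toContract Z w = y := by
  rcases x with _ | x <;> rcases y with _ | y
  · exact h.elim
  · obtain ⟨z, hz, hzy⟩ := h
    exact ⟨z, y, hzy, toContract_of_mem hz, toContract_coe y⟩
  · obtain ⟨z, hz, hzx⟩ := h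
    exact ⟨x, z, hzx.symm, toContract_coe x, toContract_of_mem hz⟩
  · exact ⟨x, y, h, toContract_coe x, toContract_coe y⟩

theorem contract_connected (hG : G.Connected) {Z : Set V} (hZ : Z.Nonempty) :
    (contract G Z).Connected := by
  have key : ∀ v w, G.Reachable v w →
      (contract G Z).Reachable (toContract Z v) (toContract Z w) := by
    intro v w h
    rw [reachable_iff_reflTransGen] at h
    induction h with
    | refl => rfl
    | @tail b c _ hbc ih =>
      by_cases hZ : b ∈ Z ∧ c ∈ Z
      · rwa [toContract_of_mem hZ.2, ← toContract_of_mem hZ.1]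
      · exact ih.trans (contract_adj_toContract hbc hZ).reachable
  have surj : Function.Surjective (toContract Z) := by
    rintro (_ | v)
    · exact ⟨_, toContract_of_mem hZ.choose_spec⟩
    · exact ⟨v, toContract_coe v⟩
  have : Nonempty (Option {v // v ∉ Z}) := ⟨none⟩
  refine ⟨fun x y => ?_⟩
  obtain ⟨v, rfl⟩ := surj x
  obtain ⟨w, rfl⟩ := surj y
  exact key v w (hG.preconnected v w)

/-- The matching induced on the contraction of `Z` by a matching `m` that leaves `Z` exactly in
the edge from `a` to `m a`. -/
noncomputable def contractMatching (m : V → V) (Z : Set V) (a : V) :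
    Option {v // v ∉ Z} → Option {v // v ∉ Z} :=
  fun x => toContract Z (m (ofContract a x))

theorem ofContract_contractMatching {m : V → V} {Z : Set V} {a : V} (hm : IsPM G m)
    (hb : m a ∉ Z) (hu : ∀ v ∈ Z, m v ∉ Z → v = a) (x : Option {v // v ∉ Z}) :
    ofContract a (contractMatching m Z a x) = m (ofContract a x) := by
  unfold contractMatching
  by_cases h : m (ofContract a x) ∈ Z
  · rw [toContract_of_mem h]
    rcases x with _ | x
    · exact absurd h hb
    · exact (hu _ h (by rw [(hm _).2]; exact x.2)).symm
  · rw [toContract_of_notMem h]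
    rfl

theorem isPM_contractMatching {m : V → V} {Z : Set V} {a : V} (hm : IsPM G m)
    (ha : a ∈ Z) (hb : m a ∉ Z) (hu : ∀ v ∈ Z, m v ∉ Z → v = a) :
    IsPM (contract G Z) (contractMatching m Z a) := by
  have hto : ∀ x : Option {v // v ∉ Z}, toContract Z (ofContract a x) = x := by
    rintro (_ | x)
    · exact toContract_of_mem ha
    · exact toContract_coe x
  intro x
  constructor
  · have := contract_adj_toContract (Z := Z) (hm (ofContract a x)).1 ?_
    · rwa [hto x] at this
    · rintro ⟨h1, h2⟩
      rcases x with _ | x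
      · exact hb h2
      · exact x.2 h1
  · apply ofContract_injective ha
    rw [ofContract_contractMatching hm hb hu, ofContract_contractMatching hm hb hu, (hm _).2]

/-- The edge of `n` at the contracted vertex comes from an edge `z c` of `G`. A perfect matching of
`G` through `z c` crosses the tight cut only there, so its part inside `Z` can be glued to `n`
outside `Z`. -/
theorem exists_lift_of_contract {Z : Set V} (hG : IsMatchingCovered G)
    (hZ : ∀ m, IsPM G m → crossing m Z = 1) {n : Option {v // v ∉ Z} → Option {v // v ∉ Z}}
    (hn : IsPM (contract G Z) n) : ∃ m, IsPM G m ∧ (∃ c, n none = some c) ∧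
      ∀ v : {v // v ∉ Z}, ∀ w, n (some v) = some w → m v = w := by
  classical
  obtain ⟨c, hc⟩ : ∃ c, n none = some c := by
    rcases h : n none with _ | c
    · exact absurd h (hn none).1.ne'
    · exact ⟨c, rfl⟩
  have hnc : n (some c) = none := (hn.eq_iff).1 hc
  obtain ⟨z, hz, hzc⟩ : ∃ z ∈ Z, G.Adj z c := by
    have := (hn none).1
    rwa [hc] at this
  obtain ⟨m', hm', hm'z⟩ := (isMatchingCovered_iff.1 hG).2 z c hzc
  obtain ⟨a, ha, hb, hu⟩ := exists_crossing_of_crossing_eq_one (hZ m' hm')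
  have hza : z = a := hu z hz (hm'z ▸ c.2)
  subst hza
  let m : V → V := fun v => if h : v ∈ Z then m' v else ofContract z (n (some ⟨v, h⟩))
  have m_in : ∀ v ∈ Z, m v = m' v := fun v h => dif_pos h
  have m_out : ∀ v : {v // v ∉ Z}, m v = ofContract z (n (some v)) := fun v => dif_neg v.2
  refine ⟨m, ?_, ⟨c, hc⟩, fun v w h => by rw [m_out, h]; rfl⟩
  intro v
  by_cases hv : v ∈ Z
  · rw [m_in v hv]
    refine ⟨(hm' v).1, ?_⟩
    by_cases hv' : m' v ∈ Z
    · rw [m_in _ hv', (hm' v).2]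
    · have := hu v hv hv'
      subst this
      rw [hm'z, m_out, hnc]
      rfl
  · lift v to {v // v ∉ Z} using hv
    rw [m_out]
    have h1 := hn (some v)
    rcases h : n (some v) with _ | w
    · have hvc : v = c := by
        rw [hn.eq_iff, hc] at h
        exact (Option.some_inj.1 h).symm
      subst hvc
      refine ⟨hzc.symm, ?_⟩
      change m z = v
      rw [m_in z hz, hm'z]
    · rw [h] at h1
      refine ⟨h1.1, ?_⟩
      change m w = v
      rw [m_out, h1.2]
      rfl

theorem contract_isMatchingCovered {Z : Set V} (hG : IsMatchingCovered G)
    (hZ : ∀ m, IsPM G m → crossing m Z = 1) (hne : Z.Nonempty) :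
    IsMatchingCovered (contract G Z) := by
  refine isMatchingCovered_iff.2 ⟨contract_connected hG.1 hne, fun x y hxy => ?_⟩
  obtain ⟨v, w, hvw, rfl, rfl⟩ := exists_adj_of_contract_adj hxy
  obtain ⟨m, hm, hmv⟩ := (isMatchingCovered_iff.1 hG).2 v w hvw
  obtain ⟨a, ha, hb, hu⟩ := exists_crossing_of_crossing_eq_one (hZ m hm)
  refine ⟨_, isPM_contractMatching hm ha hb hu, ?_⟩
  unfold contractMatching
  by_cases hv : v ∈ Z
  · have hw : w ∉ Z := by
      intro hw
      rw [toContract_of_mem hv, toContract_of_mem hw] at hxy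
      exact hxy.ne rfl
    rw [toContract_of_mem hv]
    have := hu v hv (hmv ▸ hw)
    subst this
    exact congrArg _ hmv
  · rw [toContract_of_notMem hv]
    exact congrArg _ hmv

/-- A single crossing edge makes the imbalance of `Z` equal to one, in favour of the class from
which that edge leaves. The imbalance is fixed, and every edge lies in a perfect matching, so all
edges of the cut leave `Z` from the larger class. -/
theorem exists_side_of_tight [Finite V] {A : Set V} (hA : IsSide G A) {Z : Set V}
    (hG : IsMatchingCovered G) (hZ : ∀ m, IsPM G m → crossing m Z = 1) :
    ∃ B, IsSide G B ∧ ∀ z ∈ Z, ∀ y ∉ Z, G.Adj z y → z ∈ B := by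
  by_cases h : (Z ∩ Aᶜ).ncard < (Z ∩ A).ncard
  · refine ⟨A, hA, fun z hz y hy hzy => ?_⟩
    by_contra hzA
    obtain ⟨m, hm, hmz⟩ := (isMatchingCovered_iff.1 hG).2 z y hzy
    have h1 := hA.ncard_add_crossingFrom hm Z
    have h2 := crossing_eq_add A m Z
    have h3 : 0 < crossingFrom Aᶜ m Z :=
      (Set.ncard_pos (Set.toFinite _)).2 ⟨z, ⟨hz, hzA⟩, by rwa [hmz]⟩
    have := hZ m hm
    omega
  · refine ⟨Aᶜ, hA.compl, fun z hz y hy hzy hzA => ?_⟩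
    obtain ⟨m, hm, hmz⟩ := (isMatchingCovered_iff.1 hG).2 z y hzy
    have h1 := hA.ncard_add_crossingFrom hm Z
    have h2 := crossing_eq_add A m Z
    have h3 : 0 < crossingFrom A m Z :=
      (Set.ncard_pos (Set.toFinite _)).2 ⟨z, ⟨hz, hzA⟩, by rwa [hmz]⟩
    have := hZ m hm
    omega

theorem contract_isBipartite [Finite V] (hbip : G.IsBipartite) {Z : Set V}
    (hG : IsMatchingCovered G) (hZ : ∀ m, IsPM G m → crossing m Z = 1) :
    (contract G Z).IsBipartite := by
  obtain ⟨A, hA⟩ := isBipartite_iff_exists_isSide.1 hbip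
  obtain ⟨B, hB, hBZ⟩ := exists_side_of_tight hA hG hZ
  -- The contracted vertex satisfies the condition vacuously and so joins the class `B`, which
  -- contains every end in `Z` of a cut edge.
  refine isBipartite_iff_exists_isSide.2 ⟨{x | ∀ v : {v // v ∉ Z}, x = some v → (v : V) ∈ B}, ?_⟩
  have hs : ∀ v : {v // v ∉ Z},
      (some v ∈ {x : Option {v // v ∉ Z} | ∀ v : {v // v ∉ Z}, x = some v → (v : V) ∈ B}) ↔
        (v : V) ∈ B := by
    intro v
    constructor
    · exact fun h => h v rfl
    · rintro h w hw
      rwa [← Option.some_inj.1 hw]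
  have hn : none ∈ {x : Option {v // v ∉ Z} | ∀ v : {v // v ∉ Z}, x = some v → (v : V) ∈ B} := by
    simp
  rintro (_ | v) (_ | w) h
  · exact h.elim
  · obtain ⟨z, hz, hzw⟩ := h
    have := hB z w hzw
    have := hBZ z hz w w.2 hzw
    rw [hs]
    tauto
  · obtain ⟨z, hz, hzw⟩ := h
    have := hB z v hzw
    have := hBZ z hz v v.2 hzw
    rw [hs]
    tauto
  · rw [hs, hs]
    exact hB v w h

theorem ncard_contract [Finite V] (Z : Set V) :
    Nat.card (Option {v // v ∉ Z}) = Zᶜ.ncard + 1 := by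
  rw [Finite.card_option, ← Nat.card_coe_set_eq]
  rfl

end Contractions

/-! ### Conformal splits survive contraction -/

section Descent

variable {V : Type u} {G : SimpleGraph V}

/-- Every large conformal set can be split evenly enough by a conformal set of porosity at most
two. -/
def SplitsConformal (G : SimpleGraph V) (m : V → V) : Prop :=
  ∀ J, Closed m J → 8 ≤ J.ncard → ∃ X, Closed m X ∧ (∀ n, IsPM G n → crossing n X ≤ 2) ∧
    4 ≤ (J ∩ X).ncard ∧ 4 ≤ (J \ X).ncard

/-- A conformal set of the contraction is carried into `G` by letting `a`, the end in `Z` of the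
crossing edge of `m`, stand for the contracted vertex. It need not be all of `V`, which is why the
property quantifies over every `J`. Pulling the splitting set back may add one crossing, and parity
removes it again. -/
theorem SplitsConformal.contract [Finite V] {Z : Set V} (hG : IsMatchingCovered G)
    (hZ : ∀ m, IsPM G m → crossing m Z = 1) {m : V → V} (hm : IsPM G m)
    (h : SplitsConformal G m) :
    ∃ n, IsPM (contract G Z) n ∧ SplitsConformal (contract G Z) n := by
  obtain ⟨a, ha, hb, hu⟩ := exists_crossing_of_crossing_eq_one (hZ m hm)
  refine ⟨contractMatching m Z a, isPM_contractMatching hm ha hb hu, fun J hJ hJ8 => ?_⟩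
  have inj := ofContract_injective ha
  have comm := ofContract_contractMatching hm hb hu
  have hcl : Closed m (ofContract a '' J) := by
    have key : ∀ v ∈ ofContract a '' J, m v ∈ ofContract a '' J := by
      rintro _ ⟨x, hx, rfl⟩
      exact ⟨_, (hJ x).2 hx, comm x⟩
    exact fun v => ⟨fun hv => (hm v).2 ▸ key _ hv, key v⟩
  obtain ⟨X, hX, hpor, h1, h2⟩ := h (ofContract a '' J) hcl
    (by rwa [Set.ncard_image_of_injective _ inj])
  have hX' : Closed (contractMatching m Z a) (ofContract a ⁻¹' X) := by
    intro x
    rw [Set.mem_preimage, Set.mem_preimage, comm, hX]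
  refine ⟨ofContract a ⁻¹' X, hX', fun n hn => ?_, ?_, ?_⟩
  · obtain ⟨n', hn', ⟨c, hc⟩, hlift⟩ := exists_lift_of_contract hG hZ hn
    have heven := (even_crossing_iff hn (ofContract a ⁻¹' X)).2
      (hX'.even_ncard (isPM_contractMatching hm ha hb hu))
    have hnc : n (some c) = none := (hn.eq_iff).1 hc
    -- The lift `n'` agrees with `n` away from the edge joining `none` and `c`. This edge
    -- contributes at most one vertex, namely its end in the pulled-back set.
    have hsub : ∃ x0, {x | x ∈ ofContract a ⁻¹' X ∧ n x ∉ ofContract a ⁻¹' X} ⊆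
        insert x0 (toContract Z '' {v | v ∈ X ∧ n' v ∉ X}) := by
      have main : ∀ v, v ≠ c → some v ∈ ofContract a ⁻¹' X → n (some v) ∉ ofContract a ⁻¹' X →
          some v ∈ toContract Z '' {v | v ∈ X ∧ n' v ∉ X} := by
        intro v hv h1 h2
        rcases hw : n (some v) with _ | w
        · rw [hn.eq_iff, hc] at hw
          exact absurd (Option.some_inj.1 hw).symm hv
        · refine ⟨v, ⟨h1, ?_⟩, toContract_coe v⟩
          rw [hlift v w hw]
          rwa [hw] at h2
      by_cases hcase : (none : Option {v // v ∉ Z}) ∈ ofContract a ⁻¹' X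
      · refine ⟨none, ?_⟩
        rintro (_ | v) ⟨h1, h2⟩
        · exact Set.mem_insert _ _
        · refine Set.mem_insert_of_mem _ (main v ?_ h1 h2)
          rintro rfl
          exact h2 (hnc ▸ hcase)
      · refine ⟨some c, ?_⟩
        rintro (_ | v) ⟨h1, h2⟩
        · exact absurd h1 hcase
        · by_cases hvc : v = c
          · rw [hvc]
            exact Set.mem_insert _ _
          · exact Set.mem_insert_of_mem _ (main v hvc h1 h2)
    obtain ⟨x0, hsub⟩ := hsub
    have h3 : crossing n (ofContract a ⁻¹' X) ≤ crossing n' X + 1 :=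
      (Set.ncard_le_ncard hsub (Set.toFinite _)).trans ((Set.ncard_insert_le _ _).trans
        (Nat.add_le_add_right (Set.ncard_image_le (Set.toFinite _)) 1))
    -- The crossing number is at most three and even, hence at most two.
    have := hpor n' hn'
    obtain ⟨k, hk⟩ := heven
    omega
  · rwa [← Set.ncard_image_of_injective _ inj, Set.image_inter_preimage]
  · rwa [← Set.ncard_image_of_injective _ inj, Set.image_sdiff_preimage]

end Descent

/-! ### Braces: two-extendability, crossing edges and small order -/

section Braces

variable {V : Type u} {G : SimpleGraph V}

theorem IsSide.ncard_inter_eq_of_closed [Finite V] {A : Set V} (hA : IsSide G A) {m : V → V}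
    (hm : IsPM G m) {X : Set V} (hX : Closed m X) : (X ∩ A).ncard = (X ∩ Aᶜ).ncard := by
  have h := hA.ncard_add_crossingFrom hm X
  have h0 : ∀ B : Set V, crossingFrom B m X = 0 := by
    intro B
    rw [crossingFrom, Set.ncard_eq_zero (Set.toFinite _), Set.eq_empty_iff_forall_notMem]
    exact fun v hv => hv.2 ((hX v).2 hv.1.1)
  rwa [h0, h0] at h

theorem IsSide.ncard_compl [Finite V] {A : Set V} (hA : IsSide G A) {m : V → V}
    (hm : IsPM G m) : Aᶜ.ncard = A.ncard := by
  have := hA.ncard_inter_eq_of_closed hm (X := Set.univ) (fun v => Iff.rfl)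
  rw [Set.univ_inter, Set.univ_inter] at this
  exact this.symm

theorem ncard_inter_add_inter_compl [Finite V] (X A : Set V) :
    (X ∩ A).ncard + (X ∩ Aᶜ).ncard = X.ncard := by
  rw [← Set.sdiff_eq]
  exact Set.ncard_inter_add_ncard_sdiff_eq_ncard X A (Set.toFinite _)

/-- No matching edge leaves `Z` from `A`, so the crossings from the other class equal the imbalance,
which is one. All tight cuts exhibited in braces below arise in this way. -/
theorem IsSide.crossing_eq_one [Finite V] {A : Set V} (hA : IsSide G A) {Z : Set V}
    (h1 : ∀ a ∈ Z ∩ A, ∀ y, G.Adj a y → y ∈ Z) (h2 : (Z ∩ Aᶜ).ncard = (Z ∩ A).ncard + 1)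
    {m : V → V} (hm : IsPM G m) : crossing m Z = 1 := by
  have h := hA.ncard_add_crossingFrom hm Z
  have h0 : crossingFrom A m Z = 0 := by
    rw [crossingFrom, Set.ncard_eq_zero (Set.toFinite _), Set.eq_empty_iff_forall_notMem]
    exact fun v hv => hv.2 (h1 v hv.1 _ (hm v).1)
  rw [crossing_eq_add A]
  omega

theorem IsSide.ncard_eq_one_of_no_tight_cut [Finite V] {A : Set V} (hA : IsSide G A)
    (hG : ∀ Z, ¬ IsNontrivialTightCut G Z) {Z : Set V}
    (h1 : ∀ a ∈ Z ∩ A, ∀ y, G.Adj a y → y ∈ Z) (h2 : (Z ∩ Aᶜ).ncard = (Z ∩ A).ncard + 1) :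
    Z.ncard = 1 ∨ Zᶜ.ncard = 1 := by
  by_contra! h
  exact hG Z (isNontrivialTightCut_iff.2 ⟨fun m hm => hA.crossing_eq_one h1 h2 hm, h⟩)

theorem IsSide.exists_isPM_of_injOn [Finite V] {A : Set V} (hA : IsSide G A)
    (hcard : Aᶜ.ncard = A.ncard) {f : V → V} (hf : Set.InjOn f A)
    (hadj : ∀ a ∈ A, G.Adj a (f a)) : ∃ m, IsPM G m ∧ ∀ a ∈ A, m a = f a := by
  classical
  have hmaps : f '' A ⊆ Aᶜ := by
    rintro _ ⟨a, ha, rfl⟩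
    exact fun h => (hA _ _ (hadj a ha)).1 h ha
  have himg : f '' A = Aᶜ :=
    Set.eq_of_subset_of_ncard_le hmaps (by rw [hf.ncard_image, hcard]) (Set.toFinite _)
  have hsurj : ∀ v, v ∉ A → ∃ a ∈ A, f a = v := fun v hv => by
    have : v ∈ f '' A := himg ▸ hv
    exact this
  choose g hgA hg using hsurj
  refine ⟨fun v => if h : v ∈ A then f v else g v h, fun v => ?_, fun a ha => dif_pos ha⟩
  by_cases hv : v ∈ A
  · have hfv : f v ∉ A := hmaps ⟨v, hv, rfl⟩
    simp only [dif_pos hv, dif_neg hfv]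
    exact ⟨hadj v hv, hf (hgA _ _) hv (hg _ _)⟩
  · simp only [dif_neg hv, dif_pos (hgA v hv)]
    have := hadj _ (hgA v hv)
    rw [hg] at this
    exact ⟨this.symm, hg v hv⟩

/-- A bipartite graph with a perfect matching and without nontrivial tight cuts is
`2`-extendable. -/
theorem IsSide.exists_isPM_of_two_edges [Finite V] {A : Set V} (hA : IsSide G A)
    (hG : ∀ Z, ¬ IsNontrivialTightCut G Z) (hcard : Aᶜ.ncard = A.ncard) {a₁ a₂ b₁ b₂ : V}
    (ha₁ : a₁ ∈ A) (ha₂ : a₂ ∈ A) (h₁ : G.Adj a₁ b₁) (h₂ : G.Adj a₂ b₂) (hab : a₁ ≠ a₂)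
    (hbb : b₁ ≠ b₂) : ∃ m, IsPM G m ∧ m a₁ = b₁ ∧ m a₂ = b₂ := by
  classical
  have := Fintype.ofFinite V
  have hb₁ : b₁ ∉ A := fun h => (hA _ _ h₁).1 h ha₁
  have hb₂ : b₂ ∉ A := fun h => (hA _ _ h₂).1 h ha₂
  let ι := {a // a ∈ A ∧ a ≠ a₁ ∧ a ≠ a₂}
  let t : ι → Finset V := fun a => Finset.univ.filter fun y => G.Adj a y ∧ y ≠ b₁ ∧ y ≠ b₂
  have ht : ∀ (a : ι) y, y ∈ t a ↔ G.Adj a y ∧ y ≠ b₁ ∧ y ≠ b₂ := fun a y => by simp [t]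
  -- Hall's theorem after deleting the ends of both edges. If `s` violates the condition, then its
  -- neighbours together with `b₁` and `b₂` number at most `S.ncard + 1`.
  obtain ⟨f, hf, hft⟩ := (Finset.all_card_le_biUnion_card_iff_exists_injective t).1 (by
    intro s
    by_contra! hlt
    let S : Set V := Subtype.val '' (s : Set ι)
    have hS : S.ncard = s.card := by
      rw [Set.ncard_image_of_injective _ Subtype.val_injective, Set.ncard_coe_finset]
    have hSA : S ⊆ A := by
      rintro _ ⟨a, -, rfl⟩
      exact a.2.1
    have hSlt : S.ncard + 2 ≤ A.ncard := by
      have h1 : insert a₁ (insert a₂ S) ⊆ A := by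
        rintro _ (rfl | rfl | h)
        exacts [ha₁, ha₂, hSA h]
      have h2 : a₂ ∉ S := by
        rintro ⟨a, -, h⟩
        exact a.2.2.2 h
      have h3 : a₁ ∉ insert a₂ S := by
        rintro (h | ⟨a, -, h⟩)
        · exact hab h
        · exact a.2.2.1 h
      have := Set.ncard_le_ncard h1 (Set.toFinite _)
      rwa [Set.ncard_insert_of_notMem h3, Set.ncard_insert_of_notMem h2] at this
    let U : Set V := insert b₁ (insert b₂ (s.biUnion t : Set V))
    have hU : U.ncard ≤ S.ncard + 1 := by
      have h1 : U.ncard ≤ _ := Set.ncard_insert_le b₁ _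
      have h2 := Set.ncard_insert_le b₂ (s.biUnion t : Set V)
      rw [Set.ncard_coe_finset] at h2
      omega
    have hUA : U ⊆ Aᶜ := by
      rintro _ (rfl | rfl | h)
      · exact hb₁
      · exact hb₂
      · obtain ⟨a, -, ha⟩ := Finset.mem_biUnion.1 (Finset.mem_coe.1 h)
        exact fun h => (hA _ _ ((ht a _).1 ha).1).1 h a.2.1
    -- Padding to exactly `S.ncard + 1` vertices makes the cut at `S ∪ U'` tight. Both shores have
    -- at least three vertices: `S` is nonempty and misses `a₁` and `a₂`.
    obtain ⟨U', hUU', hU'A, hU'⟩ := Set.exists_subsuperset_card_eq hUA hU (by omega)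
    have hZA : (S ∪ U') ∩ A = S := by
      ext v
      have h1 := @hSA v
      have h2 := @hU'A v
      simp only [Set.mem_inter_iff, Set.mem_union, Set.mem_compl_iff] at *
      tauto
    have hZB : (S ∪ U') ∩ Aᶜ = U' := by
      ext v
      have h1 := @hSA v
      have h2 := @hU'A v
      simp only [Set.mem_inter_iff, Set.mem_union, Set.mem_compl_iff] at *
      tauto
    have h1 := hA.ncard_eq_one_of_no_tight_cut hG (Z := S ∪ U') (by
      rw [hZA]
      rintro _ ⟨a, ha, rfl⟩ y hy
      refine Or.inr (hUU' ?_)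
      by_cases hy1 : y = b₁
      · exact Or.inl hy1
      by_cases hy2 : y = b₂
      · exact Or.inr (Or.inl hy2)
      · exact Or.inr (Or.inr (Finset.mem_coe.2 (Finset.mem_biUnion.2
          ⟨a, ha, (ht a y).2 ⟨hy, hy1, hy2⟩⟩)))) (by rw [hZA, hZB, hU'])
    have h2 := ncard_inter_add_inter_compl (S ∪ U') A
    have h3 := ncard_inter_add_inter_compl Set.univ A
    have h4 := Set.ncard_add_ncard_compl (S ∪ U')
    rw [hZA, hZB] at h2
    rw [Set.univ_inter, Set.univ_inter, Set.ncard_univ] at h3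
    omega)
  let F : V → V := fun v => if v = a₁ then b₁ else if v = a₂ then b₂ else
    if h : v ∈ A ∧ v ≠ a₁ ∧ v ≠ a₂ then f ⟨v, h⟩ else v
  have hF₁ : F a₁ = b₁ := if_pos rfl
  have hF₂ : F a₂ = b₂ := (if_neg hab.symm).trans (if_pos rfl)
  have hF : ∀ a : ι, F a = f a := fun a =>
    (if_neg a.2.2.1).trans ((if_neg a.2.2.2).trans (dif_pos a.2))
  have hcases : ∀ v ∈ A, v = a₁ ∨ v = a₂ ∨ ∃ a : ι, v = a := by
    intro v hv
    by_cases h1 : v = a₁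
    · exact Or.inl h1
    by_cases h2 : v = a₂
    · exact Or.inr (Or.inl h2)
    · exact Or.inr (Or.inr ⟨⟨v, hv, h1, h2⟩, rfl⟩)
  have hfb := fun a => (ht a _).1 (hft a)
  obtain ⟨m, hm, hmF⟩ := hA.exists_isPM_of_injOn hcard (f := F) (by
    intro v hv w hw hvw
    rcases hcases v hv with h1 | h1 | ⟨v', h1⟩ <;>
      rcases hcases w hw with h2 | h2 | ⟨w', h2⟩ <;>
      rw [h1, h2] at hvw ⊢ <;>
      simp only [hF₁, hF₂, hF] at hvw
    · exact absurd hvw hbb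
    · exact absurd hvw.symm (hfb w').2.1
    · exact absurd hvw.symm hbb
    · exact absurd hvw.symm (hfb w').2.2
    · exact absurd hvw (hfb v').2.1
    · exact absurd hvw (hfb v').2.2
    · rw [hf hvw]) (by
    intro v hv
    rcases hcases v hv with rfl | rfl | ⟨v, rfl⟩
    · rwa [hF₁]
    · rwa [hF₂]
    · rw [hF]
      exact (hfb v).1)
  exact ⟨m, hm, (hmF _ ha₁).trans hF₁, (hmF _ ha₂).trans hF₂⟩

/-- In a brace every conformal cut with two large shores is left by two disjoint edges from the
same colour class. -/
theorem IsSide.exists_two_edges [Finite V] {A : Set V} (hA : IsSide G A)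
    (hG : ∀ Z, ¬ IsNontrivialTightCut G Z) {m : V → V} (hm : IsPM G m) {X : Set V}
    (hX : Closed m X) (h4 : 4 ≤ X.ncard) (h4' : 4 ≤ Xᶜ.ncard) :
    ∃ a₁ ∈ X ∩ A, ∃ a₂ ∈ X ∩ A, ∃ b₁ ∉ X, ∃ b₂ ∉ X, a₁ ≠ a₂ ∧ b₁ ≠ b₂ ∧
      G.Adj a₁ b₁ ∧ G.Adj a₂ b₂ := by
  have e1 := hA.ncard_inter_eq_of_closed hm hX
  have e2 := hA.ncard_inter_eq_of_closed hm hX.compl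
  have e3 := ncard_inter_add_inter_compl X A
  have e4 := ncard_inter_add_inter_compl Xᶜ A
  -- If every edge leaving `X` from `A` ended in `x`, adding `x` to `X` would give a nontrivial
  -- tight cut.
  have case1 : ∀ x ∈ Xᶜ ∩ Aᶜ, ∃ a ∈ X ∩ A, ∃ b ∉ X, b ≠ x ∧ G.Adj a b := by
    rintro x ⟨hx, hxA⟩
    by_contra! hno
    have hZA : (insert x X) ∩ A = X ∩ A := Set.insert_inter_of_notMem hxA
    have hZB : (insert x X) ∩ Aᶜ = insert x (X ∩ Aᶜ) := Set.insert_inter_of_mem hxA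
    have hc : (insert x X : Set V).ncard = X.ncard + 1 := Set.ncard_insert_of_notMem hx
    have h := hA.ncard_eq_one_of_no_tight_cut hG (Z := insert x X) (by
      rw [hZA]
      intro a ha y hy
      by_contra hyn
      exact hno a ha y (fun h => hyn (Or.inr h)) (fun h => hyn (Or.inl h)) hy) (by
      rw [hZA, hZB, Set.ncard_insert_of_notMem fun h => hx h.1, e1])
    have := Set.ncard_add_ncard_compl X
    have := Set.ncard_add_ncard_compl (insert x X)
    omega
  -- If all these edges started in `x`, removing `x` from `X` would give a nontrivial tight cut.
  have case2 : ∀ x ∈ X ∩ A, ∃ a ∈ X ∩ A, ∃ b ∉ X, a ≠ x ∧ G.Adj a b := by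
    rintro x ⟨hx, hxA⟩
    by_contra! hno
    have hZA : (X \ {x}) ∩ A = (X ∩ A) \ {x} := by
      ext v
      simp only [Set.mem_inter_iff, Set.mem_sdiff]
      tauto
    have hZB : (X \ {x}) ∩ Aᶜ = X ∩ Aᶜ := by
      ext v
      simp only [Set.mem_inter_iff, Set.mem_sdiff, Set.mem_singleton_iff, Set.mem_compl_iff]
      constructor
      · tauto
      · rintro ⟨h1, h2⟩
        exact ⟨⟨h1, fun h => h2 (h ▸ hxA)⟩, h2⟩
    have hc := Set.ncard_sdiff_singleton_add_one hx (Set.toFinite _)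
    have hc' := Set.ncard_sdiff_singleton_add_one (show x ∈ X ∩ A from ⟨hx, hxA⟩) (Set.toFinite _)
    have h := hA.ncard_eq_one_of_no_tight_cut hG (Z := X \ {x}) (by
      rw [hZA]
      rintro a ⟨ha, hax⟩ y hy
      have hyA : y ∉ A := fun h => (hA a y hy).1 h ha.2
      by_contra hyn
      refine hno a ha y (fun h => hyn ⟨h, ?_⟩) hax hy
      exact fun h => hyA (h ▸ hxA)) (by
      rw [hZA, hZB, ← e1, hc'])
    have := Set.ncard_add_ncard_compl X
    have := Set.ncard_add_ncard_compl (X \ {x})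
    omega
  have hne : (Xᶜ ∩ Aᶜ).Nonempty := (Set.ncard_pos (Set.toFinite _)).1 (by omega)
  obtain ⟨x, hx⟩ := hne
  obtain ⟨a₁, ha₁, b₁, hb₁, -, h₁⟩ := case1 x hx
  obtain ⟨a₂, ha₂, b₂, hb₂, hne₂, h₂⟩ := case2 a₁ ha₁
  -- When the first two edges share the end `b₁`, a third edge avoiding `b₁` is disjoint from at
  -- least one of them.
  by_cases hb : b₁ = b₂
  · subst hb
    obtain ⟨a₃, ha₃, b₃, hb₃, hne₃, h₃⟩ := case1 b₁ ⟨hb₁, fun h => (hA _ _ h₁).1 h ha₁.2⟩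
    by_cases h31 : a₃ = a₁
    · subst h31
      exact ⟨a₃, ha₃, a₂, ha₂, b₃, hb₃, b₁, hb₁, hne₂.symm, hne₃, h₃, h₂⟩
    · exact ⟨a₃, ha₃, a₁, ha₁, b₃, hb₃, b₁, hb₁, h31, hne₃, h₃, h₁⟩
  · exact ⟨a₁, ha₁, a₂, ha₂, b₁, hb₁, b₂, hb₂, hne₂.symm, hb, h₁, h₂⟩

theorem IsSide.exists_two_lt_crossing [Finite V] {A : Set V} (hA : IsSide G A)
    (hG : ∀ Z, ¬ IsNontrivialTightCut G Z) {m : V → V} (hm : IsPM G m) {X : Set V}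
    (hX : Closed m X) (h4 : 4 ≤ X.ncard) (h4' : 4 ≤ Xᶜ.ncard) :
    ∃ n, IsPM G n ∧ 2 < crossing n X := by
  obtain ⟨a₁, ha₁, a₂, ha₂, b₁, hb₁, b₂, hb₂, ha, hb, h₁, h₂⟩ :=
    hA.exists_two_edges hG hm hX h4 h4'
  obtain ⟨n, hn, hn₁, hn₂⟩ := hA.exists_isPM_of_two_edges hG (hA.ncard_compl hm) ha₁.2 ha₂.2
    h₁ h₂ ha hb
  refine ⟨n, hn, ?_⟩
  -- `X` is balanced, so the two crossings from `A` are matched by two from the other class.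
  have e1 := hA.ncard_inter_eq_of_closed hm hX
  have e2 := hA.ncard_add_crossingFrom hn X
  have e3 := crossing_eq_add A n X
  have : 2 ≤ crossingFrom A n X := by
    rw [← Set.ncard_pair ha]
    refine Set.ncard_le_ncard ?_ (Set.toFinite _)
    rintro _ (rfl | rfl)
    · exact ⟨ha₁, hn₁ ▸ hb₁⟩
    · exact ⟨ha₂, hn₂ ▸ hb₂⟩
  omega

theorem SplitsConformal.card_lt_of_brace [Finite V] {m : V → V} (h : SplitsConformal G m)
    (hm : IsPM G m) (hG : IsBrace G) : Nat.card V < 8 := by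
  by_contra! hc
  obtain ⟨A, hA⟩ := isBipartite_iff_exists_isSide.1 hG.1
  obtain ⟨X, hX, hpor, h1, h2⟩ := h Set.univ (fun _ => Iff.rfl) (by rwa [Set.ncard_univ])
  rw [Set.univ_inter] at h1
  rw [← Set.compl_eq_univ_sdiff] at h2
  obtain ⟨n, hn, hlt⟩ := hA.exists_two_lt_crossing hG.2.2 hm hX h1 h2
  exact absurd (hpor n hn) (by omega)

/-- A small brace is complete bipartite. -/
theorem IsBrace.adj_of_ncard_le [Finite V] (hG : IsBrace G) {A : Set V} (hA : IsSide G A)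
    {m : V → V} (hm : IsPM G m) (h2 : 2 ≤ A.ncard) (h3 : A.ncard ≤ 3) {a b : V} (ha : a ∈ A)
    (hb : b ∉ A) : G.Adj a b := by
  by_contra hab
  have hAc := hA.ncard_compl hm
  have htot := Set.ncard_add_ncard_compl A
  have hn : ∀ y, G.Adj a y → y ∈ Aᶜ \ {b} := by
    intro y hy
    exact ⟨fun h => (hA a y hy).1 h ha, fun h => hab (h ▸ hy)⟩
  have hbc := Set.ncard_sdiff_singleton_add_one (show b ∈ Aᶜ from hb) (Set.toFinite _)
  have ha' : a ∉ Aᶜ \ {b} := fun h => h.1 ha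
  -- With three vertices per class, a non-edge `a b` makes `a` and the other class without `b` a
  -- tight shore of size three. With two per class, `a` has a unique neighbour `b'`, whose only
  -- neighbour must be `a`; this contradicts connectedness.
  by_cases h : A.ncard = 3
  · have hZA : (insert a (Aᶜ \ {b})) ∩ A = {a} := by
      ext v
      simp only [Set.mem_inter_iff, Set.mem_insert_iff, Set.mem_sdiff, Set.mem_compl_iff,
        Set.mem_singleton_iff]
      constructor
      · tauto
      · rintro rfl
        exact ⟨Or.inl rfl, ha⟩
    have hZB : (insert a (Aᶜ \ {b})) ∩ Aᶜ = Aᶜ \ {b} := by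
      ext v
      simp only [Set.mem_inter_iff, Set.mem_insert_iff, Set.mem_sdiff, Set.mem_compl_iff,
        Set.mem_singleton_iff]
      constructor
      · rintro ⟨rfl | h, h'⟩
        · exact absurd ha h'
        · exact h
      · tauto
    have hc : (insert a (Aᶜ \ {b}) : Set V).ncard = _ := Set.ncard_insert_of_notMem ha'
    have hk := hA.ncard_eq_one_of_no_tight_cut hG.2.2 (Z := insert a (Aᶜ \ {b})) (by
      rw [hZA]
      rintro _ rfl y hy
      exact Or.inr (hn y hy)) (by
      rw [hZA, hZB, Set.ncard_singleton]
      omega)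
    have := Set.ncard_add_ncard_compl (insert a (Aᶜ \ {b}))
    omega
  · obtain ⟨b', hb'⟩ := Set.ncard_eq_one.1 (show (Aᶜ \ {b}).ncard = 1 by omega)
    have hnb : ∀ y, G.Adj a y → y = b' := fun y hy => by
      have := hn y hy
      rwa [hb'] at this
    have hmc := isMatchingCovered_iff.1 hG.2.1
    have hn' : ∀ y, G.Adj b' y → y = a := by
      intro y hy
      obtain ⟨n, hn, hny⟩ := hmc.2 b' y hy
      have : n a = b' := hnb _ (hn a).1
      rw [hn.eq_iff, hny] at this
      exact this
    have hreach : ∀ y, G.Reachable a y → y = a ∨ y = b' := by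
      intro y hy
      rw [reachable_iff_reflTransGen] at hy
      induction hy with
      | refl => exact Or.inl rfl
      | tail _ hyz ih =>
        rcases ih with rfl | rfl
        · exact Or.inr (hnb _ hyz)
        · exact Or.inl (hn' _ hyz)
    rcases hreach b (hmc.1.preconnected a b) with h | h
    · exact hb (h ▸ ha)
    · have : b' ∈ Aᶜ \ {b} := by rw [hb']; rfl
      exact this.2 h.symm

/-- A complete bipartite graph with colour classes of size `k` is `K_{k,k}`. -/
theorem nonempty_iso_completeBipartiteGraph [Finite V] {A : Set V} (hA : IsSide G A) {k : ℕ}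
    (h1 : A.ncard = k) (h2 : Aᶜ.ncard = k) (hadj : ∀ a ∈ A, ∀ b ∉ A, G.Adj a b) :
    Nonempty (completeBipartiteGraph (Fin k) (Fin k) ≃g G) := by
  classical
  obtain ⟨e1⟩ := Finite.card_eq.1 (show Nat.card (Fin k) = Nat.card A by
    rw [Nat.card_coe_set_eq, h1, Nat.card_fin])
  obtain ⟨e2⟩ := Finite.card_eq.1 (show Nat.card (Fin k) = Nat.card (Aᶜ : Set V) by
    rw [Nat.card_coe_set_eq, h2, Nat.card_fin])
  refine ⟨⟨(Equiv.sumCongr e1 e2).trans (Equiv.Set.sumCompl A), ?_⟩⟩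
  rintro (x | x) (y | y)
  · simp only [Equiv.trans_apply, Equiv.sumCongr_apply, Sum.map_inl, Equiv.Set.sumCompl_apply_inl,
      completeBipartiteGraph_adj]
    have := hA (e1 x) (e1 y)
    have := (e1 x).2
    have := (e1 y).2
    simp
    tauto
  · simpa using hadj _ (e1 x).2 _ (e2 y).2
  · simpa using (hadj _ (e1 y).2 _ (e2 x).2).symm
  · simp only [Equiv.trans_apply, Equiv.sumCongr_apply, Sum.map_inr, Equiv.Set.sumCompl_apply_inr,
      completeBipartiteGraph_adj]
    have := hA (e2 x) (e2 y)
    have hx : (e2 x : V) ∉ A := (e2 x).2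
    have hy : (e2 y : V) ∉ A := (e2 y).2
    simp
    tauto

theorem nonempty_iso_cycleGraph_four :
    Nonempty (completeBipartiteGraph (Fin 2) (Fin 2) ≃g cycleGraph 4) := by
  have hA : IsSide (cycleGraph 4) {0, 2} := by
    unfold IsSide
    simp only [Set.mem_insert_iff, Set.mem_singleton_iff]
    decide
  refine nonempty_iso_completeBipartiteGraph hA (Set.ncard_pair (by decide)) ?_ ?_
  · have : ({0, 2} : Set (Fin 4))ᶜ = {1, 3} := by
      ext x
      simp only [Set.mem_compl_iff, Set.mem_insert_iff, Set.mem_singleton_iff]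
      revert x
      decide
    rw [this, Set.ncard_pair (by decide)]
  · simp only [Set.mem_insert_iff, Set.mem_singleton_iff]
    decide

theorem IsBrace.nonempty_iso [Finite V] (hG : IsBrace G) {m : V → V} (hm : IsPM G m)
    (h4 : 4 ≤ Nat.card V) (h8 : Nat.card V < 8) :
    Nonempty (G ≃g cycleGraph 4) ∨ Nonempty (G ≃g completeBipartiteGraph (Fin 3) (Fin 3)) := by
  obtain ⟨A, hA⟩ := isBipartite_iff_exists_isSide.1 hG.1
  have h1 := hA.ncard_compl hm
  have h2 := Set.ncard_add_ncard_compl A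
  have hadj : ∀ a ∈ A, ∀ b ∉ A, G.Adj a b := fun a ha b hb =>
    hG.adj_of_ncard_le hA hm (by omega) (by omega) ha hb
  by_cases h : A.ncard = 2
  · obtain ⟨e⟩ := nonempty_iso_completeBipartiteGraph hA h (h1.trans h) hadj
    obtain ⟨e'⟩ := nonempty_iso_cycleGraph_four
    exact Or.inl ⟨e.symm.trans e'⟩
  · have h : A.ncard = 3 := by omega
    obtain ⟨e⟩ := nonempty_iso_completeBipartiteGraph hA h (h1.trans h) hadj
    exact Or.inr ⟨e.symm⟩

end Braces

/-! ### Every brace of a graph with conformal splits is small -/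

section Descent

variable {V : Type u} {G : SimpleGraph V}

/-- A shore of a tight cut has odd size, so one that is not a single vertex has at least three. -/
theorem four_le_card_contract [Finite V] {m : V → V} (hm : IsPM G m) {Z : Set V}
    (h : IsNontrivialTightCut G Z) : 4 ≤ Nat.card (Option {v // v ∉ Z}) := by
  rw [ncard_contract]
  rw [isNontrivialTightCut_iff] at h
  have hodd : ¬ Even Zᶜ.ncard := by
    rw [← even_crossing_iff hm, crossing_compl hm, h.1 m hm]
    decide
  have h3 := h.2.2
  rw [Nat.not_even_iff_odd] at hodd
  obtain ⟨k, hk⟩ := hodd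
  omega

theorem IsNontrivialTightCut.nonempty [Finite V] {m : V → V} (hm : IsPM G m) {Z : Set V}
    (h : IsNontrivialTightCut G Z) : Z.Nonempty := by
  obtain ⟨a, ha, -⟩ := exists_crossing_of_crossing_eq_one ((isNontrivialTightCut_iff.1 h).1 m hm)
  exact ⟨a, ha⟩

theorem OccursInTightCutDecomposition.splitsConformal [Finite V] (hG : IsMatchingCovered G)
    (h4 : 4 ≤ Nat.card V) {m : V → V} (hm : IsPM G m) (hs : SplitsConformal G m) {W : Type u}
    {H : SimpleGraph W} (h : OccursInTightCutDecomposition G H) :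
    Finite W ∧ IsMatchingCovered H ∧ 4 ≤ Nat.card W ∧ ∃ n, IsPM H n ∧ SplitsConformal H n := by
  induction h with
  | start => exact ⟨‹_›, hG, h4, m, hm, hs⟩
  | contract Z _ hZ ih =>
    obtain ⟨hfin, hmc, -, n, hn, hsn⟩ := ih
    have hZ' := (isNontrivialTightCut_iff.1 hZ).1
    exact ⟨inferInstance, contract_isMatchingCovered hmc hZ' (hZ.nonempty hn),
      four_le_card_contract hn hZ, hsn.contract hmc hZ' hn⟩

theorem nonempty_iso_of_splitsConformal [Finite V] (hG : IsMatchingCovered G)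
    (h4 : 4 ≤ Nat.card V) {m : V → V} (hm : IsPM G m) (hs : SplitsConformal G m) {W : Type u}
    {H : SimpleGraph W} (h : IsBraceOf H G) :
    Nonempty (H ≃g cycleGraph 4) ∨ Nonempty (H ≃g completeBipartiteGraph (Fin 3) (Fin 3)) := by
  obtain ⟨hfin, -, h4', n, hn, hsn⟩ := h.1.splitsConformal hG h4 hm hs
  exact h.2.nonempty_iso hn h4' (hsn.card_lt_of_brace hn h.2)

end Descent

/-! ### Branches of a tree at an edge -/

section Branches

variable {N : Type*} {T : SimpleGraph N}

/-- The component of `t₁` in the graph without the edge `t₁t₂`. -/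
def branch (T : SimpleGraph N) (t₁ t₂ : N) : Set N :=
  {s | (T.deleteEdges {s(t₁, t₂)}).Reachable t₁ s}

theorem mem_branch_self (t₁ t₂ : N) : t₁ ∈ branch T t₁ t₂ :=
  Reachable.refl (G := T.deleteEdges {s(t₁, t₂)}) t₁

theorem mem_branch_of_adj {t₁ t₂ y z : N} (hy : y ∈ branch T t₁ t₂) (h : T.Adj y z)
    (hne : s(y, z) ≠ s(t₁, t₂)) : z ∈ branch T t₁ t₂ :=
  Reachable.trans hy (Adj.reachable (by rw [SimpleGraph.deleteEdges_adj]; exact ⟨h, hne⟩))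

theorem branch_subset {t₁ t₂ : N} {C : Set N} (h1 : t₁ ∈ C)
    (h2 : ∀ y ∈ C, ∀ z, T.Adj y z → s(y, z) ≠ s(t₁, t₂) → z ∈ C) : branch T t₁ t₂ ⊆ C := by
  intro x (hx : Reachable _ _ _)
  rw [reachable_iff_reflTransGen] at hx
  induction hx with
  | refl => exact h1
  | tail _ hyz ih =>
    rw [SimpleGraph.deleteEdges_adj] at hyz
    exact h2 _ ih _ hyz.1 hyz.2

theorem branch_compl (hT : T.IsTree) {t₁ t₂ : N} (h : T.Adj t₁ t₂) :
    (branch T t₁ t₂)ᶜ = branch T t₂ t₁ := by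
  have hbr : ¬ (T.deleteEdges {s(t₁, t₂)}).Reachable t₁ t₂ :=
    isAcyclic_iff_forall_adj_isBridge.1 hT.isAcyclic h
  have hcov : ∀ x, x ∈ branch T t₁ t₂ ∨ x ∈ branch T t₂ t₁ := by
    intro x
    have hx := hT.connected.preconnected t₁ x
    rw [reachable_iff_reflTransGen] at hx
    induction hx with
    | refl => exact Or.inl (mem_branch_self _ _)
    | @tail y z _ hyz ih =>
      by_cases he : s(y, z) = s(t₁, t₂)
      · rcases Sym2.eq_iff.1 he with ⟨-, rfl⟩ | ⟨-, rfl⟩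
        · exact Or.inr (mem_branch_self _ _)
        · exact Or.inl (mem_branch_self _ _)
      · exact ih.imp (fun hy => mem_branch_of_adj hy hyz he)
          (fun hy => mem_branch_of_adj hy hyz (by rwa [Sym2.eq_swap (a := t₂)]))
  ext x
  refine ⟨fun hx => (hcov x).resolve_left hx, fun hx hx' => hbr ?_⟩
  have hx2 : (T.deleteEdges {s(t₂, t₁)}).Reachable t₂ x := hx
  rw [Sym2.eq_swap] at hx2
  exact Reachable.trans hx' hx2.symm

theorem notMem_branch (hT : T.IsTree) {t₁ t₂ : N} (h : T.Adj t₁ t₂) : t₂ ∉ branch T t₁ t₂ := by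
  rw [← branch_compl hT h.symm]
  exact fun h' => h' (mem_branch_self _ _)

theorem branch_ssubset (hT : T.IsTree) {t₁ t₂ s : N} (h : T.Adj t₁ t₂) (hs : T.Adj t₁ s)
    (hne : s ≠ t₂) : branch T s t₁ ⊂ branch T t₁ t₂ := by
  refine ⟨?_, fun h' => notMem_branch hT hs.symm (h' (mem_branch_self _ _))⟩
  have : branch T s t₁ ⊆ branch T s t₁ ∩ branch T t₁ t₂ := by
    refine branch_subset ⟨mem_branch_self _ _, mem_branch_of_adj (mem_branch_self _ _) hs ?_⟩ ?_
    · rw [Ne, Sym2.eq_iff]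
      rintro (⟨-, h1⟩ | ⟨h1, -⟩)
      · exact hne h1
      · exact h.ne h1
    · rintro y ⟨hy1, hy2⟩ z hyz hne'
      have hz := mem_branch_of_adj hy1 hyz hne'
      refine ⟨hz, mem_branch_of_adj hy2 hyz ?_⟩
      rw [Ne, Sym2.eq_iff]
      rintro (⟨rfl, -⟩ | ⟨-, rfl⟩)
      · exact notMem_branch hT hs.symm hy1
      · exact notMem_branch hT hs.symm hz
  exact fun x hx => (this hx).2

theorem branch_subset_insert (t₁ t₂ : N) :
    branch T t₁ t₂ ⊆ {x | x = t₁ ∨ ∃ s, T.Adj t₁ s ∧ s ≠ t₂ ∧ x ∈ branch T s t₁} := by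
  refine branch_subset (Or.inl rfl) ?_
  rintro y (rfl | ⟨s, hs, hst, hy⟩) z hyz hne
  · exact Or.inr ⟨z, hyz, fun h => hne (h ▸ rfl), mem_branch_self _ _⟩
  · by_cases he : s(y, z) = s(s, t₁)
    · rcases Sym2.eq_iff.1 he with ⟨-, rfl⟩ | ⟨-, rfl⟩
      · exact Or.inl rfl
      · exact Or.inr ⟨z, hs, hst, mem_branch_self _ _⟩
    · exact Or.inr ⟨s, hs, hst, mem_branch_of_adj hy hyz he⟩

end Branches

/-! ### Balanced edges of a decomposition and bounds on the width -/

namespace PMDecomposition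

variable {V : Type u} (D : PMDecomposition V)

theorem mem_shore {t₁ t₂ : D.Node} {v : V} :
    v ∈ D.shore t₁ t₂ ↔ (D.leafEquiv.symm v : D.Node) ∈ branch D.tree t₁ t₂ := Iff.rfl

theorem shore_compl {t₁ t₂ : D.Node} (h : D.tree.Adj t₁ t₂) :
    (D.shore t₁ t₂)ᶜ = D.shore t₂ t₁ := by
  ext v
  rw [Set.mem_compl_iff, mem_shore, mem_shore, ← branch_compl D.isTree h]
  rfl

theorem ncard_shore_le_one [Finite V] {t₁ t₂ : D.Node} (h : D.tree.Adj t₁ t₂)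
    (hl : IsLeaf D.tree t₁) : (D.shore t₁ t₂).ncard ≤ 1 := by
  rw [Set.ncard_le_one (Set.toFinite _)]
  obtain ⟨x, hx⟩ := Set.ncard_eq_one.1 hl
  have hx' : ∀ s, D.tree.Adj t₁ s → s = x := fun s hs => by
    have : s ∈ D.tree.neighborSet t₁ := hs
    rwa [hx] at this
  have key : ∀ v ∈ D.shore t₁ t₂, (D.leafEquiv.symm v : D.Node) = t₁ := by
    intro v hv
    rcases branch_subset_insert _ _ hv with h' | ⟨s, hs, hne, -⟩
    · exact h'
    · exact absurd ((hx' s hs).trans (hx' t₂ h).symm) hne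
  intro v hv w hw
  exact D.leafEquiv.symm.injective (Subtype.ext ((key v hv).trans (key w hw).symm))

theorem exists_shore_subset_union {t₁ t₂ : D.Node} (h : D.tree.Adj t₁ t₂)
    (hl : ¬ IsLeaf D.tree t₁) : ∃ s₁ s₂, D.tree.Adj t₁ s₁ ∧ D.tree.Adj t₁ s₂ ∧ s₁ ≠ t₂ ∧ s₂ ≠ t₂ ∧
      D.shore t₁ t₂ ⊆ D.shore s₁ t₁ ∪ D.shore s₂ t₁ := by
  obtain ⟨x, y, z, hxy, hxz, hyz, he⟩ := Set.ncard_eq_three.1 ((D.cubic t₁).resolve_left hl)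
  have hmem : ∀ s, D.tree.Adj t₁ s ↔ s = x ∨ s = y ∨ s = z := fun s => by
    have : s ∈ D.tree.neighborSet t₁ ↔ s ∈ ({x, y, z} : Set D.Node) := by rw [he]
    exact this
  have hsub : ∀ v ∈ D.shore t₁ t₂, ∃ s, D.tree.Adj t₁ s ∧ s ≠ t₂ ∧ v ∈ D.shore s t₁ := by
    intro v hv
    rcases branch_subset_insert _ _ hv with h' | h'
    · exact absurd (h' ▸ (D.leafEquiv.symm v).2) hl
    · exact h'
  have main : ∀ a b, D.tree.Adj t₁ a → D.tree.Adj t₁ b → a ≠ t₂ → b ≠ t₂ →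
      (∀ s, D.tree.Adj t₁ s → s ≠ t₂ → s = a ∨ s = b) →
      ∃ s₁ s₂, D.tree.Adj t₁ s₁ ∧ D.tree.Adj t₁ s₂ ∧ s₁ ≠ t₂ ∧ s₂ ≠ t₂ ∧
      D.shore t₁ t₂ ⊆ D.shore s₁ t₁ ∪ D.shore s₂ t₁ := by
    intro a b ha hb hat hbt hab
    refine ⟨a, b, ha, hb, hat, hbt, fun v hv => ?_⟩
    obtain ⟨s, hs, hst, hvs⟩ := hsub v hv
    rcases hab s hs hst with rfl | rfl
    · exact Or.inl hvs
    · exact Or.inr hvs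
  have hx := (hmem x).2 (Or.inl rfl)
  have hy := (hmem y).2 (Or.inr (Or.inl rfl))
  have hz := (hmem z).2 (Or.inr (Or.inr rfl))
  rcases (hmem t₂).1 h with rfl | rfl | rfl
  · exact main y z hy hz hxy.symm hxz.symm fun s hs hne => ((hmem s).1 hs).resolve_left hne
  · exact main x z hx hz hxy hyz.symm fun s hs hne => by
      have := (hmem s).1 hs
      tauto
  · exact main x y hx hy hxz hyz fun s hs hne => by
      have := (hmem s).1 hs
      tauto

/-- Some edge of the tree induces a cut with more than `k` and at most `2k` elements of `J` on
one side. -/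
theorem exists_balanced_shore [Finite V] {J : Set V} {k : ℕ} (hk : 1 ≤ k)
    (hJ : 2 * k < J.ncard) : ∃ t₁ t₂, D.tree.Adj t₁ t₂ ∧ k < (J ∩ D.shore t₁ t₂).ncard ∧
      (J ∩ D.shore t₁ t₂).ncard ≤ 2 * k := by
  have := D.finite_node
  have start : ∃ t₁ t₂, D.tree.Adj t₁ t₂ ∧ k < (J ∩ D.shore t₁ t₂).ncard := by
    obtain ⟨t₁⟩ := D.isTree.connected.nonempty
    obtain ⟨t₂, h : D.tree.Adj t₁ t₂⟩ : (D.tree.neighborSet t₁).Nonempty := by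
      rw [← Set.ncard_pos (Set.toFinite _)]
      rcases D.cubic t₁ with h | h <;> omega
    have hsum := ncard_inter_add_inter_compl J (D.shore t₁ t₂)
    rw [shore_compl D h] at hsum
    by_cases hlt : k < (J ∩ D.shore t₁ t₂).ncard
    · exact ⟨t₁, t₂, h, hlt⟩
    · exact ⟨t₂, t₁, h.symm, by omega⟩
  obtain ⟨t₁, t₂, h, hlt⟩ := start
  -- Walk into the tree: while a branch holds more than `2 * k` elements of `J`, it is not a leaf
  -- and one of its two subbranches holds more than `k`. Branches shrink strictly, so the walk
  -- stops.
  induction hn : (branch D.tree t₁ t₂).ncard using Nat.strong_induction_on generalizing t₁ t₂ with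
  | _ n ih =>
    subst hn
    by_cases hle : (J ∩ D.shore t₁ t₂).ncard ≤ 2 * k
    · exact ⟨t₁, t₂, h, hlt, hle⟩
    have hl : ¬ IsLeaf D.tree t₁ := by
      intro hl
      have h1 := D.ncard_shore_le_one h hl
      have h2 : (J ∩ D.shore t₁ t₂).ncard ≤ (D.shore t₁ t₂).ncard :=
        Set.ncard_le_ncard Set.inter_subset_right (Set.toFinite _)
      omega
    obtain ⟨s₁, s₂, h1, h2, hs1, hs2, hsub⟩ := D.exists_shore_subset_union h hl
    have hcard : (J ∩ D.shore t₁ t₂).ncard ≤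
        (J ∩ D.shore s₁ t₁).ncard + (J ∩ D.shore s₂ t₁).ncard := by
      refine le_trans (Set.ncard_le_ncard ?_ (Set.toFinite _)) (Set.ncard_union_le _ _)
      rw [← Set.inter_union_distrib_left]
      exact Set.inter_subset_inter_right _ hsub
    by_cases hlt' : k < (J ∩ D.shore s₁ t₁).ncard
    · exact ih _ (Set.ncard_lt_ncard (branch_ssubset D.isTree h h1 hs1) (Set.toFinite _))
        s₁ t₁ h1.symm hlt' rfl
    · exact ih _ (Set.ncard_lt_ncard (branch_ssubset D.isTree h h2 hs2) (Set.toFinite _))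
        s₂ t₁ h2.symm (by omega) rfl

theorem width_le_iff [Finite V] {G : SimpleGraph V} {k : ℕ} :
    D.width G ≤ k ↔ ∀ t₁ t₂, D.tree.Adj t₁ t₂ → ∀ m, IsPM G m →
      crossing m (D.shore t₁ t₂) ≤ k := by
  constructor
  · intro h t₁ t₂ ht
    rw [← porosity_le_iff]
    refine le_trans ?_ h
    refine le_csSup ⟨Nat.card V, ?_⟩ ⟨t₁, t₂, ht, rfl⟩
    rintro _ ⟨s₁, s₂, -, rfl⟩
    rw [porosity_le_iff]
    exact fun m _ => (crossing_le_card _ _).trans (Set.ncard_le_card _)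
  · intro h
    refine csSup_le' ?_
    rintro _ ⟨t₁, t₂, ht, rfl⟩
    exact porosity_le_iff.2 (h t₁ t₂ ht)

theorem splitsConformal [Finite V] {G : SimpleGraph V} {m : V → V} (hm : IsPM G m)
    {M : G.Subgraph} (hM : ∀ v w, M.Adj v w ↔ m v = w) (hD : D.IsMDecomposition M)
    (hw : D.width G ≤ 2) : SplitsConformal G m := by
  intro J hJ hJ8
  -- The shore receives three or four elements of `J`; once the edge is known to be inner, the shore
  -- is conformal and parity leaves exactly four.
  obtain ⟨t₁, t₂, h, h1, h2⟩ := D.exists_balanced_shore (J := J) (k := 2) (by omega) (by omega)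
  have hsum := ncard_inter_add_inter_compl J (D.shore t₁ t₂)
  have hsub : ∀ t₁ t₂, (J ∩ D.shore t₁ t₂).ncard ≤ (D.shore t₁ t₂).ncard := fun t₁ t₂ =>
    Set.ncard_le_ncard Set.inter_subset_right (Set.toFinite _)
  have hl1 : ¬ IsLeaf D.tree t₁ := by
    intro hl
    have := D.ncard_shore_le_one h hl
    have := hsub t₁ t₂
    omega
  have hl2 : ¬ IsLeaf D.tree t₂ := by
    intro hl
    have := D.ncard_shore_le_one h.symm hl
    have := hsub t₂ t₁
    rw [D.shore_compl h] at hsum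
    omega
  have hX : Closed m (D.shore t₁ t₂) := (isConformal_iff hM hm _).1 (hD t₁ t₂ h hl1 hl2).1
  obtain ⟨j, hj⟩ := (hJ.inter hX).even_ncard hm
  refine ⟨_, hX, D.width_le_iff.1 hw t₁ t₂ h, by omega, ?_⟩
  rw [Set.sdiff_eq]
  omega

/-- Some shore has exactly two vertices. By connectedness an edge leaves it, a perfect matching uses
that edge, and its crossing number is even, hence at least two. -/
theorem two_le_width [Finite V] {G : SimpleGraph V} (hG : IsMatchingCovered G)
    (h4 : 4 ≤ Nat.card V) : 2 ≤ D.width G := by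
  by_contra! hlt
  obtain ⟨t₁, t₂, h, h1, h2⟩ := D.exists_balanced_shore (J := Set.univ) (k := 1) le_rfl (by
    rw [Set.ncard_univ]
    omega)
  rw [Set.univ_inter] at h1 h2
  have hX : (D.shore t₁ t₂).ncard = 2 := by omega
  obtain ⟨x, hx⟩ : (D.shore t₁ t₂).Nonempty := (Set.ncard_pos (Set.toFinite _)).1 (by omega)
  obtain ⟨y, hy⟩ : (D.shore t₁ t₂)ᶜ.Nonempty := by
    have := Set.ncard_add_ncard_compl (D.shore t₁ t₂)
    exact (Set.ncard_pos (Set.toFinite _)).1 (by omega)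
  have hcross : ∃ v ∈ D.shore t₁ t₂, ∃ w ∉ D.shore t₁ t₂, G.Adj v w := by
    by_contra! hno
    have hr := hG.1.preconnected x y
    rw [reachable_iff_reflTransGen] at hr
    refine hy ?_
    clear hy
    induction hr with
    | refl => exact hx
    | tail _ hbc ih => exact by_contra fun hc => hno _ ih _ hc hbc
  obtain ⟨v, hv, w, hw, hvw⟩ := hcross
  obtain ⟨m, hm, hmv⟩ := (isMatchingCovered_iff.1 hG).2 v w hvw
  have hpos : 0 < crossing m (D.shore t₁ t₂) :=
    (Set.ncard_pos (Set.toFinite _)).2 ⟨v, hv, by rwa [hmv]⟩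
  have heven : Even (crossing m (D.shore t₁ t₂)) := by
    rw [even_crossing_iff hm, hX]
    decide
  have := D.width_le_iff.1 (show D.width G ≤ 1 by omega) t₁ t₂ h m hm
  obtain ⟨j, hj⟩ := heven
  omega

/-- With fewer than four vertices, one of the two shores has at most one. -/
theorem width_le_one [Finite V] {G : SimpleGraph V} (h : Nat.card V < 4) : D.width G ≤ 1 := by
  rw [width_le_iff]
  intro t₁ t₂ ht m hm
  have h1 := Set.ncard_add_ncard_compl (D.shore t₁ t₂)
  have h2 := crossing_le_card m (D.shore t₁ t₂)
  have h3 := crossing_le_card m (D.shore t₁ t₂)ᶜ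
  rw [crossing_compl hm] at h3
  omega

end PMDecomposition

/-! ### Hierarchies of conformal sets and their gluing along tight cuts -/

section Hierarchies

variable {V : Type u} {G : SimpleGraph V}

/-- `X` is partitioned into matching edges by a binary hierarchy of conformal sets of porosity at
most two. -/
inductive HasHierarchy (G : SimpleGraph V) (m : V → V) : Set V → Prop
  | pair (v : V) : HasHierarchy G m {v, m v}
  | union {X Y : Set V} : HasHierarchy G m X → HasHierarchy G m Y → Disjoint X Y →
      (∀ n, IsPM G n → crossing n (X ∪ Y) ≤ 2) → HasHierarchy G m (X ∪ Y)

theorem closed_pair {m : V → V} (hm : IsPM G m) (v : V) : Closed m {v, m v} := by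
  intro w
  simp only [Set.mem_insert_iff, Set.mem_singleton_iff]
  constructor
  · rintro (h | h)
    · exact Or.inr (hm.eq_iff.1 h).symm
    · exact Or.inl (hm.injective h)
  · rintro (rfl | rfl)
    · exact Or.inr rfl
    · exact Or.inl (hm v).2

theorem pair_eq_of_mem {m : V → V} (hm : IsPM G m) {v w : V} (h : v ∈ ({w, m w} : Set V)) :
    ({v, m v} : Set V) = {w, m w} := by
  rcases h with rfl | rfl
  · rfl
  · rw [(hm w).2, Set.pair_comm]

theorem HasHierarchy.closed {m : V → V} (hm : IsPM G m) {X : Set V} (h : HasHierarchy G m X) :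
    Closed m X := by
  induction h with
  | pair v => exact closed_pair hm v
  | union _ _ _ _ h1 h2 => exact h1.union h2

/-- Descend in the hierarchy towards the pair containing `v`. The complement of a child is the union
of its sibling and the complement of the parent, and it has the same porosity as the child, so it
acquires a hierarchy as well. -/
theorem HasHierarchy.reroot_aux [Finite V] {m : V → V} (hm : IsPM G m) {X : Set V}
    (h : HasHierarchy G m X) (hc : HasHierarchy G m Xᶜ) (v : V) (hv : v ∈ X) :
    HasHierarchy G m {v, m v}ᶜ := by
  have step : ∀ X Y : Set V, Disjoint X Y → HasHierarchy G m X → HasHierarchy G m Y →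
      (∀ n, IsPM G n → crossing n Y ≤ 2) →
      HasHierarchy G m (X ∪ Y)ᶜ → HasHierarchy G m Yᶜ := by
    intro X Y hXY hX hY hpor hc
    have heq : Yᶜ = X ∪ (X ∪ Y)ᶜ := by
      ext w
      have : w ∈ X → w ∉ Y := fun h => Set.disjoint_left.1 hXY h
      simp only [Set.mem_compl_iff, Set.mem_union]
      tauto
    rw [heq]
    refine hX.union hc (Set.disjoint_left.2 fun w h1 h2 => h2 (Or.inl h1)) fun n hn => ?_
    rw [← heq, crossing_compl hn]
    exact hpor n hn
  have hpor : ∀ Y, HasHierarchy G m Y → ∀ n, IsPM G n → crossing n Y ≤ 2 := by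
    intro Y hY n hn
    cases hY with
    | pair v => exact crossing_pair_le n v (m v)
    | union _ _ _ h => exact h n hn
  induction h with
  | pair w => rwa [pair_eq_of_mem hm hv]
  | @union X Y hX hY hXY _ ihX ihY =>
    rcases hv with hv | hv
    · rw [Set.union_comm] at hc
      exact ihX (step Y X hXY.symm hY hX (hpor X hX) hc) hv
    · exact ihY (step X Y hXY hX hY (hpor Y hY) hc) hv

theorem HasHierarchy.reroot [Finite V] {m : V → V} (hm : IsPM G m) {X : Set V}
    (h : HasHierarchy G m X) (hc : HasHierarchy G m Xᶜ) (v : V) :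
    HasHierarchy G m {v, m v}ᶜ := by
  by_cases hv : v ∈ X
  · exact h.reroot_aux hm hc v hv
  · exact hc.reroot_aux hm (by rwa [compl_compl]) v hv

/-- For a set avoiding the contracted vertex, contracting a perfect matching of `G` loses no
crossings, so porosity bounds lift from the contraction. -/
theorem HasHierarchy.of_contract [Finite V] {m : V → V} (hm : IsPM G m) {Z : Set V}
    (hZ : ∀ n, IsPM G n → crossing n Z = 1) {a : V} (ha : a ∈ Z) (hb : m a ∉ Z)
    (hu : ∀ v ∈ Z, m v ∉ Z → v = a) {Y : Set (Option {v // v ∉ Z})}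
    (h : HasHierarchy (contract G Z) (contractMatching m Z a) Y) (hY : none ∉ Y) :
    HasHierarchy G m (ofContract a '' Y) := by
  induction h with
  | pair x =>
    rw [Set.image_insert_eq, Set.image_singleton, ofContract_contractMatching hm hb hu]
    exact .pair _
  | @union X Y _ _ hXY hpor ihX ihY =>
    rw [Set.image_union]
    refine (ihX fun h => hY (Or.inl h)).union (ihY fun h => hY (Or.inr h))
      ((Set.disjoint_image_iff (ofContract_injective ha)).2 hXY) fun n hn => ?_
    rw [← Set.image_union]
    -- The matching `n` may leave `Z` at a vertex other than `a`; this does not matter, because the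
    -- sets considered lie outside `Z`.
    obtain ⟨a', ha', hb', hu'⟩ := exists_crossing_of_crossing_eq_one (hZ n hn)
    refine le_trans ?_ (hpor _ (isPM_contractMatching hn ha' hb' hu'))
    unfold crossing
    rw [← Set.ncard_image_of_injective _ (ofContract_injective ha)]
    refine Set.ncard_le_ncard ?_ (Set.toFinite _)
    rintro _ ⟨⟨x, hx, rfl⟩, hout⟩
    refine ⟨x, ⟨hx, fun hx' => hout ?_⟩, rfl⟩
    rcases x with _ | x
    · exact absurd hx hY
    rcases hy : contractMatching n Z a' (some x) with _ | y
    · exact absurd (hy ▸ hx') hY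
    · refine ⟨some y, hy ▸ hx', ?_⟩
      exact (toContract_eq_some_iff.1 hy).symm

theorem ofContract_image_compl_pair {m : V → V} {Z : Set V} {a : V} (hb : m a ∉ Z) :
    ofContract a '' ({none, contractMatching m Z a none}ᶜ : Set (Option {v // v ∉ Z})) =
      Zᶜ \ {m a} := by
  have hnone : contractMatching m Z a none = some ⟨m a, hb⟩ := toContract_of_notMem hb
  rw [hnone]
  ext v
  constructor
  · rintro ⟨_ | x, hx, rfl⟩
    · exact absurd (Or.inl rfl) hx
    · refine ⟨x.2, fun h => hx (Or.inr ?_)⟩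
      exact congrArg some (Subtype.ext h)
  · rintro ⟨h1, h2⟩
    refine ⟨some ⟨v, h1⟩, ?_, rfl⟩
    rintro (h | h)
    · exact Option.some_ne_none _ h
    · exact h2 (congrArg Subtype.val (Option.some_inj.1 h))

/-- At most two matching edges remain. Their union is the complement of a pair and thus has porosity
at most two. -/
theorem hasHierarchy_of_card [Finite V] {m : V → V} (hm : IsPM G m)
    (h : Nat.card V = 4 ∨ Nat.card V = 6) (v : V) : HasHierarchy G m {v, m v}ᶜ := by
  have hpair : ∀ v : V, ({v, m v} : Set V).ncard = 2 := fun v => Set.ncard_pair (hm v).1.ne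
  have hcl := (closed_pair hm v).compl
  have hsum := Set.ncard_add_ncard_compl ({v, m v} : Set V)
  rw [hpair] at hsum
  obtain ⟨w, hw⟩ : ({v, m v}ᶜ : Set V).Nonempty := (Set.ncard_pos (Set.toFinite _)).1 (by omega)
  have hsub : ({w, m w} : Set V) ⊆ {v, m v}ᶜ := by
    rintro _ (rfl | rfl)
    · exact hw
    · exact (hcl w).2 hw
  rcases h with h | h
  · rw [← Set.eq_of_subset_of_ncard_le hsub (by rw [hpair]; omega) (Set.toFinite _)]
    exact .pair w
  · have hsum2 := Set.ncard_sdiff_add_ncard_of_subset hsub (Set.toFinite _)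
    rw [hpair] at hsum2
    obtain ⟨x, hx⟩ : (({v, m v}ᶜ : Set V) \ {w, m w}).Nonempty :=
      (Set.ncard_pos (Set.toFinite _)).1 (by omega)
    have hsub2 : ({x, m x} : Set V) ⊆ {v, m v}ᶜ \ {w, m w} := by
      rintro _ (rfl | rfl)
      · exact hx
      · exact ⟨(hcl x).2 hx.1, fun h => hx.2 ((closed_pair hm w x).1 h)⟩
    have heq2 := Set.eq_of_subset_of_ncard_le hsub2 (by rw [hpair]; omega) (Set.toFinite _)
    have heq : ({v, m v}ᶜ : Set V) = {w, m w} ∪ {x, m x} := by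
      rw [heq2, Set.union_sdiff_cancel hsub]
    rw [heq]
    refine (HasHierarchy.pair w).union (.pair x) ?_ fun n hn => ?_
    · rw [heq2]
      exact Set.disjoint_sdiff_right
    · rw [← heq, crossing_compl hn]
      exact crossing_pair_le _ _ _

theorem OccursInTightCutDecomposition.trans {W W' : Type u} {H : SimpleGraph W}
    {K : SimpleGraph W'} (h1 : OccursInTightCutDecomposition G H)
    (h2 : OccursInTightCutDecomposition H K) : OccursInTightCutDecomposition G K := by
  induction h2 with
  | start => exact h1
  | contract Z _ hZ ih => exact .contract Z ih hZ

theorem IsNontrivialTightCut.card_contract_lt [Finite V] {m : V → V} (hm : IsPM G m) {Z : Set V}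
    (h : IsNontrivialTightCut G Z) : Nat.card (Option {v // v ∉ Z}) < Nat.card V := by
  rw [ncard_contract]
  have h1 := Set.ncard_add_ncard_compl Z
  have h2 := (Set.ncard_pos (Set.toFinite _)).2 (h.nonempty hm)
  have h3 := h.2.1
  omega

/-- By induction on the order, both contractions of a nontrivial tight cut have hierarchies that
omit the matching edge at the contracted vertex. Their union omits precisely the edge of `m` in the
cut and has the porosity of that pair. -/
theorem hasHierarchy_of_forall_brace {V : Type u} [Finite V] {G : SimpleGraph V}
    (hbip : G.IsBipartite) (hG : IsMatchingCovered G)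
    (hbr : ∀ (W : Type u) (H : SimpleGraph W), IsBraceOf H G →
        Nonempty (H ≃g SimpleGraph.cycleGraph 4) ∨
          Nonempty (H ≃g completeBipartiteGraph (Fin 3) (Fin 3)))
    {m : V → V} (hm : IsPM G m) (v : V) : HasHierarchy G m {v, m v}ᶜ := by
  induction hN : Nat.card V using Nat.strong_induction_on generalizing V with
  | _ N ih =>
    subst hN
    by_cases hnt : ∃ Z, IsNontrivialTightCut G Z
    · have part : ∀ Z, IsNontrivialTightCut G Z → ∀ a ∈ Z, m a ∉ Z →
          HasHierarchy G m (Zᶜ \ {m a}) := by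
        intro Z hZ a ha hb
        have hZ1 := (isNontrivialTightCut_iff.1 hZ).1
        obtain ⟨a', ha', hb', hu⟩ := exists_crossing_of_crossing_eq_one (hZ1 m hm)
        have := hu a ha hb
        subst this
        rw [← ofContract_image_compl_pair hb]
        refine HasHierarchy.of_contract hm hZ1 ha hb hu ?_ (fun h => h (Or.inl rfl))
        refine ih _ (hZ.card_contract_lt hm) (contract_isBipartite hbip hG hZ1)
          (contract_isMatchingCovered hG hZ1 ⟨a, ha⟩) ?_ (isPM_contractMatching hm ha hb hu)
          none rfl
        exact fun W H h => hbr W H ⟨(OccursInTightCutDecomposition.contract Z .start hZ).trans h.1,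
          h.2⟩
      obtain ⟨Z, hZ⟩ := hnt
      obtain ⟨a, ha, hb, hu⟩ :=
        exists_crossing_of_crossing_eq_one ((isNontrivialTightCut_iff.1 hZ).1 m hm)
      have h1 := part Z hZ a ha hb
      have h2 := part Zᶜ hZ.compl (m a) hb (by
        rw [(hm a).2]
        exact fun h => h ha)
      rw [compl_compl, (hm a).2] at h2
      have heq : ({a, m a}ᶜ : Set V) = (Zᶜ \ {m a}) ∪ (Z \ {a}) := by
        ext w
        have h1 : w = a → w ∈ Z := by
          rintro rfl
          exact ha
        have h2 : w = m a → w ∉ Z := by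
          rintro rfl
          exact hb
        simp only [Set.mem_compl_iff, Set.mem_insert_iff, Set.mem_singleton_iff, Set.mem_union,
          Set.mem_sdiff]
        tauto
      -- The cut dictates the omitted edge, whereas `v` is arbitrary.
      refine HasHierarchy.reroot hm (.pair a) ?_ v
      rw [heq]
      refine h1.union h2 (Set.disjoint_left.2 fun w hw hw' => hw.1 hw'.1) fun n hn => ?_
      rw [← heq, crossing_compl hn]
      exact crossing_pair_le _ _ _
    · push Not at hnt
      refine hasHierarchy_of_card hm ?_ v
      rcases hbr V G ⟨.start, hbip, hG, hnt⟩ with ⟨⟨e⟩⟩ | ⟨⟨e⟩⟩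
      · left
        rw [Nat.card_congr e.toEquiv, Nat.card_fin]
      · right
        rw [Nat.card_congr e.toEquiv]
        simp

end Hierarchies

/-! ### Trees of words -/

section SuffixTrees

variable {α : Type*}

/-- The tree on a suffix-closed set of words in which each nonempty word is joined to its tail. -/
def suffixTree (A : Set (List α)) : SimpleGraph A where
  Adj x y := ∃ b, x.1 = b :: y.1 ∨ y.1 = b :: x.1
  symm := ⟨fun _ _ ⟨b, h⟩ => ⟨b, h.symm⟩⟩
  loopless := ⟨fun x ⟨b, h⟩ => by
    rcases h with h | h <;> simpa using congrArg List.length h⟩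

theorem suffixTree_adj {A : Set (List α)} {x y : A} :
    (suffixTree A).Adj x y ↔ ∃ b, x.1 = b :: y.1 ∨ y.1 = b :: x.1 := Iff.rfl

theorem branch_suffixTree {A : Set (List α)} (hA : ∀ b l, b :: l ∈ A → l ∈ A) {x y : A} {b : α}
    (hxy : x.1 = b :: y.1) : branch (suffixTree A) x y = {z | x.1 <:+ z.1} := by
  apply Set.Subset.antisymm
  · refine branch_subset List.suffix_rfl ?_
    rintro z hz w ⟨c, hc | hc⟩ hne
    · have hz' : x.1 <:+ z.1 := hz
      rw [hc, List.suffix_cons_iff] at hz'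
      refine hz'.resolve_left fun h => hne ?_
      have h1 : z = x := Subtype.ext (hc.trans h.symm)
      have h2 : w = y := Subtype.ext (by
        rw [hxy] at h
        exact (List.cons.inj h).2.symm)
      rw [h1, h2]
    · change x.1 <:+ w.1
      rw [hc]
      exact List.suffix_cons_iff.2 (Or.inr hz)
  · rintro ⟨z, hzA⟩ ⟨l, hl⟩
    dsimp only at hl
    subst hl
    induction l with
    | nil => exact mem_branch_self _ _
    | cons c l ih =>
      refine mem_branch_of_adj (ih (hA _ _ hzA)) ⟨c, Or.inr rfl⟩ fun h => ?_
      have h3 := congrArg List.length hxy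
      rcases Sym2.eq_iff.1 h with ⟨-, h1⟩ | ⟨h2, -⟩
      · have := congrArg (fun z : A => z.1.length) h1
        simp at this h3
        omega
      · have := congrArg (fun z : A => z.1.length) h2
        simp at this h3
        omega

theorem suffixTree_isTree {A : Set (List α)} (hA : ∀ b l, b :: l ∈ A → l ∈ A) (h0 : [] ∈ A) :
    (suffixTree A).IsTree := by
  have : Nonempty A := ⟨⟨[], h0⟩⟩
  have hroot : ∀ x : A, (suffixTree A).Reachable x ⟨[], h0⟩ := by
    rintro ⟨x, hx⟩
    induction x with
    | nil => rfl
    | cons b l ih =>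
      exact (Adj.reachable (suffixTree_adj.2 ⟨b, Or.inl rfl⟩)).trans (ih (hA b l hx))
  refine ⟨⟨fun x y => (hroot x).trans (hroot y).symm⟩, ?_⟩
  rw [isAcyclic_iff_forall_adj_isBridge]
  have key : ∀ x y : A, ∀ b, x.1 = b :: y.1 → y ∉ branch (suffixTree A) x y := by
    intro x y b h
    rw [branch_suffixTree hA h]
    intro (hy : x.1 <:+ y.1)
    have h1 := hy.length_le
    rw [h, List.length_cons] at h1
    omega
  rintro x y ⟨b, h | h⟩
  · exact key x y b h
  · rw [Sym2.eq_swap]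
    exact key y x b h

end SuffixTrees

/-- Binary trees with labelled leaves. -/
inductive BinTree (V : Type u) : Type u
  | leaf (v : V) : BinTree V
  | node (L R : BinTree V) : BinTree V

/-! ### Addresses and leaves of binary trees -/

namespace BinTree

variable {V : Type u}

/-- One of the two children of the root. -/
def child (b : Bool) : BinTree V → Option (BinTree V)
  | leaf _ => none
  | node L R => some (cond b R L)

/-- The subtree at an address; the last step of the way from the root is the head of the list. -/
def sub (t : BinTree V) : List Bool → Option (BinTree V)
  | [] => some t
  | b :: l => (sub t l).bind (child b)

/-- The labels of the leaves. -/
def leaves : BinTree V → Set V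
  | leaf v => {v}
  | node L R => leaves L ∪ leaves R

/-- Different leaves have different labels. -/
def Nodup : BinTree V → Prop
  | leaf _ => True
  | node L R => Disjoint (leaves L) (leaves R) ∧ Nodup L ∧ Nodup R

theorem sub_append (t : BinTree V) (l' l : List Bool) :
    sub t (l' ++ l) = (sub t l).bind fun s => sub s l' := by
  induction l' with
  | nil => simp [sub]
  | cons b l' ih =>
    rw [List.cons_append, sub, ih, Option.bind_assoc]
    rfl

theorem sub_leaf_eq_some_iff {v : V} {l : List Bool} {s : BinTree V} :
    sub (leaf v) l = some s ↔ l = [] ∧ s = leaf v := by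
  rcases List.eq_nil_or_concat' l with rfl | ⟨l', b, rfl⟩
  · simp [sub, eq_comm]
  · simp [sub_append, sub, child]

theorem sub_node_eq_some_iff {L R : BinTree V} {l : List Bool} {s : BinTree V} :
    sub (node L R) l = some s ↔ (l = [] ∧ s = node L R) ∨
      (∃ l', l = l' ++ [false] ∧ sub L l' = some s) ∨
      ∃ l', l = l' ++ [true] ∧ sub R l' = some s := by
  rcases List.eq_nil_or_concat' l with rfl | ⟨l', b, rfl⟩
  · constructor
    · exact fun h => Or.inl ⟨rfl, (Option.some_inj.1 h).symm⟩
    · rintro (⟨-, rfl⟩ | ⟨l', h, -⟩ | ⟨l', h, -⟩)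
      · rfl
      · simp at h
      · simp at h
  · rw [sub_append]
    cases b <;> simp [sub, child]

theorem mem_leaves {t : BinTree V} {v : V} : v ∈ t.leaves ↔ ∃ l, sub t l = some (leaf v) := by
  induction t with
  | leaf w =>
    simp only [sub_leaf_eq_some_iff, exists_eq_left, leaf.injEq]
    rfl
  | node L R ihL ihR =>
    change v ∈ leaves L ∨ v ∈ leaves R ↔ _
    rw [ihL, ihR]
    constructor
    · rintro (⟨l, hl⟩ | ⟨l, hl⟩)
      · exact ⟨l ++ [false], sub_node_eq_some_iff.2 (Or.inr (Or.inl ⟨l, rfl, hl⟩))⟩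
      · exact ⟨l ++ [true], sub_node_eq_some_iff.2 (Or.inr (Or.inr ⟨l, rfl, hl⟩))⟩
    · rintro ⟨l, hl⟩
      rcases sub_node_eq_some_iff.1 hl with ⟨-, h⟩ | ⟨l, -, h⟩ | ⟨l, -, h⟩
      · cases h
      · exact Or.inl ⟨l, h⟩
      · exact Or.inr ⟨l, h⟩

theorem Nodup.eq_of_sub_eq_leaf {t : BinTree V} (ht : t.Nodup) {v : V} {l l' : List Bool}
    (h : sub t l = some (leaf v)) (h' : sub t l' = some (leaf v)) : l = l' := by
  induction t generalizing l l' with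
  | leaf w => rw [(sub_leaf_eq_some_iff.1 h).1, (sub_leaf_eq_some_iff.1 h').1]
  | node L R ihL ihR =>
    obtain ⟨hd, hL, hR⟩ := ht
    rcases sub_node_eq_some_iff.1 h with ⟨-, e⟩ | ⟨k, rfl, hk⟩ | ⟨k, rfl, hk⟩
    · cases e
    · rcases sub_node_eq_some_iff.1 h' with ⟨-, e⟩ | ⟨k', rfl, hk'⟩ | ⟨k', rfl, hk'⟩
      · cases e
      · rw [ihL hL hk hk']
      · exact absurd (mem_leaves.2 ⟨_, hk'⟩) (Set.disjoint_left.1 hd (mem_leaves.2 ⟨_, hk⟩))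
    · rcases sub_node_eq_some_iff.1 h' with ⟨-, e⟩ | ⟨k', rfl, hk'⟩ | ⟨k', rfl, hk'⟩
      · cases e
      · exact absurd (mem_leaves.2 ⟨_, hk⟩) (Set.disjoint_left.1 hd (mem_leaves.2 ⟨_, hk'⟩))
      · rw [ihR hR hk hk']

theorem finite_addresses (t : BinTree V) : {l | ∃ s, sub t l = some s}.Finite := by
  induction t with
  | leaf v =>
    refine (Set.finite_singleton []).subset ?_
    rintro l ⟨s, hs⟩
    exact (sub_leaf_eq_some_iff.1 hs).1
  | node L R ihL ihR =>
    refine ((Set.finite_singleton []).union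
      ((ihL.image (· ++ [false])).union (ihR.image (· ++ [true])))).subset ?_
    rintro l ⟨s, hs⟩
    rcases sub_node_eq_some_iff.1 hs with ⟨h, -⟩ | ⟨k, rfl, h⟩ | ⟨k, rfl, h⟩
    · exact Or.inl h
    · exact Or.inr (Or.inl ⟨k, ⟨s, h⟩, rfl⟩)
    · exact Or.inr (Or.inr ⟨k, ⟨s, h⟩, rfl⟩)

end BinTree

open BinTree

/-! ### From a hierarchy to a cubic decomposition tree -/

section Construction

variable {V : Type u}

/-- The addresses of the tree `t` without the left child of the root. -/
def prunedAddresses (t : BinTree V) : Set (List Bool) :=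
  {l | (∃ s, sub t l = some s) ∧ l ≠ [false]}

/-- The cubic tree obtained from a binary tree whose left subtree is a leaf by contracting the edge
from the root to that leaf. -/
abbrev prunedTree (t : BinTree V) : SimpleGraph (prunedAddresses t) :=
  suffixTree (prunedAddresses t)

variable {r : V} {R : BinTree V}

theorem sub_leaf_node_false {s : BinTree V} {l : List Bool}
    (h : sub (node (leaf r) R) (l ++ [false]) = some s) : l = [] ∧ s = leaf r := by
  rw [sub_append] at h
  exact sub_leaf_eq_some_iff.1 h

theorem tail_mem_prunedAddresses (b : Bool) (l : List Bool)
    (h : b :: l ∈ prunedAddresses (node (leaf r) R)) : l ∈ prunedAddresses (node (leaf r) R) := by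
  obtain ⟨⟨s, hs⟩, -⟩ := h
  rw [sub] at hs
  obtain ⟨s', hs', hc⟩ := Option.bind_eq_some_iff.1 hs
  refine ⟨⟨s', hs'⟩, ?_⟩
  rintro rfl
  have := (sub_leaf_node_false (l := []) hs').2
  subst this
  cases hc

theorem nil_mem_prunedAddresses : [] ∈ prunedAddresses (node (leaf r) R) :=
  ⟨⟨_, rfl⟩, by simp⟩

theorem prunedTree_isTree : (prunedTree (node (leaf r) R)).IsTree :=
  suffixTree_isTree tail_mem_prunedAddresses nil_mem_prunedAddresses

theorem isLeaf_prunedTree_nil {x : prunedAddresses (node (leaf r) R)} (hx : x.1 = []) :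
    IsLeaf (prunedTree (node (leaf r) R)) x := by
  refine Set.ncard_eq_one.2 ⟨⟨[true], ⟨R, rfl⟩, by simp⟩, ?_⟩
  ext y
  constructor
  · rintro ⟨b, h | h⟩
    · simp [hx] at h
    · rw [hx] at h
      cases b
      · exact absurd h y.2.2
      · exact Subtype.ext h
  · rintro rfl
    exact ⟨true, Or.inr (by rw [hx])⟩

theorem isLeaf_prunedTree_of_leaf {x : prunedAddresses (node (leaf r) R)} {v : V}
    (hx : sub (node (leaf r) R) x.1 = some (leaf v)) :
    IsLeaf (prunedTree (node (leaf r) R)) x := by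
  obtain ⟨_ | ⟨b, l⟩, hxA⟩ := x
  · cases hx
  refine Set.ncard_eq_one.2 ⟨⟨l, tail_mem_prunedAddresses b l hxA⟩, ?_⟩
  ext y
  constructor
  · rintro ⟨c, h | h⟩
    · exact Subtype.ext (List.cons.inj h).2.symm
    · obtain ⟨⟨s, hs⟩, -⟩ := y.2
      rw [h, sub, hx] at hs
      cases hs
  · rintro rfl
    exact ⟨b, Or.inl rfl⟩

theorem ncard_neighborSet_prunedTree {x : prunedAddresses (node (leaf r) R)} (h0 : x.1 ≠ [])
    {S S' : BinTree V} (hx : sub (node (leaf r) R) x.1 = some (node S S')) :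
    ((prunedTree (node (leaf r) R)).neighborSet x).ncard = 3 := by
  obtain ⟨_ | ⟨b, l⟩, hxA⟩ := x
  · exact absurd rfl h0
  have hmem : ∀ c, c :: b :: l ∈ prunedAddresses (node (leaf r) R) := fun c =>
    ⟨⟨cond c S' S, by rw [sub, hx]; rfl⟩, by simp⟩
  refine Set.ncard_eq_three.2 ⟨⟨l, tail_mem_prunedAddresses b l hxA⟩, ⟨_, hmem false⟩,
    ⟨_, hmem true⟩, ?_, ?_, ?_, ?_⟩
  · intro h
    have := congrArg List.length (congrArg Subtype.val h)
    simp only [List.length_cons] at this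
    omega
  · intro h
    have := congrArg List.length (congrArg Subtype.val h)
    simp only [List.length_cons] at this
    omega
  · simp
  · ext y
    constructor
    · rintro ⟨c, h | h⟩
      · exact Or.inl (Subtype.ext (List.cons.inj h).2.symm)
      · cases c
        · exact Or.inr (Or.inl (Subtype.ext h))
        · exact Or.inr (Or.inr (Subtype.ext h))
    · rintro (rfl | rfl | rfl)
      · exact ⟨b, Or.inl rfl⟩
      · exact ⟨false, Or.inr rfl⟩
      · exact ⟨true, Or.inr rfl⟩

theorem isLeaf_prunedTree_iff {x : prunedAddresses (node (leaf r) R)} :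
    IsLeaf (prunedTree (node (leaf r) R)) x ↔
      x.1 = [] ∨ ∃ v, sub (node (leaf r) R) x.1 = some (leaf v) := by
  refine ⟨fun h => ?_, ?_⟩
  · by_contra! hno
    obtain ⟨⟨_ | ⟨S, S'⟩, hs⟩, -⟩ := x.2
    · exact hno.2 _ hs
    · have := ncard_neighborSet_prunedTree hno.1 hs
      unfold IsLeaf at h
      omega
  · rintro (h | ⟨v, h⟩)
    · exact isLeaf_prunedTree_nil h
    · exact isLeaf_prunedTree_of_leaf h

theorem prunedTree_cubic (x : prunedAddresses (node (leaf r) R)) :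
    ((prunedTree (node (leaf r) R)).neighborSet x).ncard = 1 ∨
      ((prunedTree (node (leaf r) R)).neighborSet x).ncard = 3 := by
  by_cases h0 : x.1 = []
  · exact Or.inl (isLeaf_prunedTree_nil h0)
  · obtain ⟨⟨_ | ⟨S, S'⟩, hs⟩, -⟩ := x.2
    · exact Or.inl (isLeaf_prunedTree_of_leaf hs)
    · exact Or.inr (ncard_neighborSet_prunedTree h0 hs)

/-- A binary tree with leaf set `V` whose left subtree is a leaf gives a decomposition whose
nontrivial shores are the leaf sets of subtrees. -/
theorem exists_pmDecomposition {t : BinTree V} (ht : t = node (leaf r) R) (hnd : t.Nodup)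
    (huniv : t.leaves = Set.univ) : ∃ D : PMDecomposition V, ∀ t₁ t₂, D.tree.Adj t₁ t₂ →
      ¬ IsLeaf D.tree t₁ → ¬ IsLeaf D.tree t₂ → ∃ b l S S', l ≠ [] ∧
        sub t (b :: l) = some (node S S') ∧
        (D.shore t₁ t₂ = leaves (node S S') ∨ D.shore t₂ t₁ = leaves (node S S')) := by
  classical
  subst ht
  have hex : ∀ v, ∃ l, sub (node (leaf r) R) l = some (leaf v) := fun v => by
    rw [← mem_leaves, huniv]
    trivial
  choose addr haddr using hex
  have huniq : ∀ {v l}, sub (node (leaf r) R) l = some (leaf v) → l = addr v := fun h =>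
    hnd.eq_of_sub_eq_leaf h (haddr _)
  have haddr_r : addr r = [false] := (huniq (l := [false]) rfl).symm
  have haddr_ne : ∀ v, v ≠ r → addr v ≠ [false] := by
    intro v hv h
    have := haddr v
    rw [h] at this
    exact hv (BinTree.leaf.inj (Option.some_inj.1 this)).symm
  -- The root of a binary tree has degree two. Once its left leaf is pruned, the root is itself a
  -- leaf and takes over the label `r`.
  let g : V → {x // IsLeaf (prunedTree (node (leaf r) R)) x} := fun v =>
    if hv : v = r then ⟨⟨[], nil_mem_prunedAddresses⟩, isLeaf_prunedTree_nil rfl⟩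
    else ⟨⟨addr v, ⟨_, haddr v⟩, haddr_ne v hv⟩, isLeaf_prunedTree_of_leaf (haddr v)⟩
  have g_r : (g r).1.1 = [] := by simp [g]
  have g_ne : ∀ v, v ≠ r → (g v).1.1 = addr v := fun v hv => by simp [g, hv]
  have addr_ne_nil : ∀ v, addr v ≠ [] := by
    intro v h
    have := haddr v
    rw [h] at this
    cases this
  have hbij : Function.Bijective g := by
    constructor
    · intro v w hvw
      have hvw' : (g v).1.1 = (g w).1.1 := by rw [hvw]
      by_cases hv : v = r <;> by_cases hw : w = r
      · rw [hv, hw]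
      · rw [hv, g_r, g_ne w hw] at hvw'
        exact absurd hvw'.symm (addr_ne_nil w)
      · rw [hw, g_r, g_ne v hv] at hvw'
        exact absurd hvw' (addr_ne_nil v)
      · rw [g_ne v hv, g_ne w hw] at hvw'
        have h1 := haddr v
        rw [hvw', haddr w] at h1
        exact (BinTree.leaf.inj (Option.some_inj.1 h1)).symm
    · rintro ⟨x, hx⟩
      rcases isLeaf_prunedTree_iff.1 hx with h | ⟨v, h⟩
      · exact ⟨r, Subtype.ext (Subtype.ext (g_r.trans h.symm))⟩
      · have hv : v ≠ r := by
          rintro rfl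
          exact x.2.2 ((huniq h).trans haddr_r)
        exact ⟨v, Subtype.ext (Subtype.ext ((g_ne v hv).trans (huniq h).symm))⟩
  let D : PMDecomposition V :=
    -- Addresses are lists of booleans, so the nodes live in `Type` whatever the universe of `V`.
    { Node := prunedAddresses (node (leaf r) R)
      finite_node := ((finite_addresses _).subset fun l hl => hl.1).to_subtype
      tree := prunedTree (node (leaf r) R)
      isTree := prunedTree_isTree
      cubic := prunedTree_cubic
      leafEquiv := (Equiv.ofBijective g hbij).symm }
  have hshore : ∀ x y : prunedAddresses (node (leaf r) R), ∀ b, x.1 = b :: y.1 → ∀ s,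
      sub (node (leaf r) R) x.1 = some s → D.shore x y = leaves s := by
    intro x y b hxy s hs
    ext v
    have h1 : v ∈ D.shore x y ↔ x.1 <:+ (g v).1.1 := by
      change (g v).1 ∈ branch (suffixTree (prunedAddresses (node (leaf r) R))) x y ↔ _
      rw [branch_suffixTree tail_mem_prunedAddresses hxy]
      rfl
    have h2 : v ∈ leaves s ↔ x.1 <:+ addr v := by
      rw [mem_leaves]
      have : ∀ l, sub s l = some (leaf v) ↔ l ++ x.1 = addr v := by
        intro l
        have e : sub (node (leaf r) R) (l ++ x.1) = sub s l := by
          rw [sub_append, hs]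
          rfl
        rw [← e]
        exact ⟨huniq, fun h => h ▸ haddr v⟩
      simp only [this]
      rfl
    rw [h1, h2]
    -- The label `r` has moved from `[false]` to `[]`. Only the address `[false]`, which was pruned,
    -- could tell the two apart as a suffix.
    by_cases hv : v = r
    · subst hv
      rw [g_r, haddr_r, List.suffix_cons_iff, List.suffix_nil]
      have := x.2.2
      tauto
    · rw [g_ne v hv]
  have main : ∀ x y : prunedAddresses (node (leaf r) R), ∀ b, x.1 = b :: y.1 →
      ¬ IsLeaf D.tree x → ¬ IsLeaf D.tree y → ∃ b l S S', l ≠ [] ∧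
        sub (node (leaf r) R) (b :: l) = some (node S S') ∧ D.shore x y = leaves (node S S') := by
    intro x y b hxy hx hy
    obtain ⟨⟨_ | ⟨S, S'⟩, hs⟩, -⟩ := x.2
    · exact absurd (isLeaf_prunedTree_of_leaf hs) hx
    · exact ⟨b, y.1, S, S', fun h => hy (isLeaf_prunedTree_nil h), by rw [← hxy, hs],
        hshore x y b hxy _ hs⟩
  refine ⟨D, ?_⟩
  rintro x y ⟨b, hxy | hxy⟩ hx hy
  · obtain ⟨b, l, S, S', h1, h2, h3⟩ := main x y b hxy hx hy
    exact ⟨b, l, S, S', h1, h2, Or.inl h3⟩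
  · obtain ⟨b, l, S, S', h1, h2, h3⟩ := main y x b hxy hy hx
    exact ⟨b, l, S, S', h1, h2, Or.inr h3⟩

theorem HasHierarchy.exists_binTree {G : SimpleGraph V} {m : V → V} (hm : IsPM G m) [Finite V]
    {X : Set V} (h : HasHierarchy G m X) : ∃ t : BinTree V, t.leaves = X ∧ t.Nodup ∧
      ∀ l S S', sub t l = some (node S S') → Closed m (leaves (node S S')) ∧
        ∀ n, IsPM G n → crossing n (leaves (node S S')) ≤ 2 := by
  induction h with
  | pair v =>
    refine ⟨node (leaf v) (leaf (m v)), rfl, ⟨?_, trivial, trivial⟩, ?_⟩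
    · exact Set.disjoint_singleton.2 (hm v).1.ne
    · intro l S S' h
      simp only [sub_node_eq_some_iff, sub_leaf_eq_some_iff] at h
      rcases h with ⟨-, h⟩ | ⟨_, -, -, h⟩ | ⟨_, -, -, h⟩
      · rw [h]
        exact ⟨closed_pair hm v, fun n _ => crossing_pair_le n v (m v)⟩
      · cases h
      · cases h
  | union hX hY hXY hpor ihX ihY =>
    obtain ⟨s, rfl, hs, hs'⟩ := ihX
    obtain ⟨t, rfl, ht, ht'⟩ := ihY
    refine ⟨node s t, rfl, ⟨hXY, hs, ht⟩, ?_⟩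
    intro l S S' h
    rcases sub_node_eq_some_iff.1 h with ⟨-, h⟩ | ⟨k, -, h⟩ | ⟨k, -, h⟩
    · rw [h]
      exact ⟨(hX.closed hm).union (hY.closed hm), hpor⟩
    · exact hs' k S S' h
    · exact ht' k S S' h

theorem HasHierarchy.exists_pmDecomposition [Finite V] {G : SimpleGraph V} {m : V → V}
    (hm : IsPM G m) {M : G.Subgraph} (hM : ∀ v w, M.Adj v w ↔ m v = w) {r : V}
    (h : HasHierarchy G m {r, m r}ᶜ) :
    ∃ D : PMDecomposition V, D.IsMDecomposition M ∧ D.width G ≤ 2 := by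
  obtain ⟨t, hleaves, hnd, ht⟩ := h.exists_binTree hm
  -- The ends of the omitted edge are attached as two leaves above `t`, so that every inner edge of
  -- the pruned tree cuts off a subtree of `t`.
  obtain ⟨D, hD⟩ := PMWidth.exists_pmDecomposition (t := node (leaf r) (node (leaf (m r)) t)) rfl
    (by
      refine ⟨Set.disjoint_singleton_left.2 ?_, trivial, Set.disjoint_singleton_left.2 ?_,
        trivial, hnd⟩
      · rintro (h | h)
        · exact (hm r).1.ne h
        · rw [hleaves] at h
          exact h (Or.inl rfl)
      · rw [hleaves]
        exact fun h => h (Or.inr rfl))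
    (by
      rw [Set.eq_univ_iff_forall]
      intro v
      by_cases hv : v = r
      · exact Or.inl hv
      by_cases hv' : v = m r
      · exact Or.inr (Or.inl hv')
      · refine Or.inr (Or.inr ?_)
        rw [hleaves]
        rintro (h | h)
        · exact hv h
        · exact hv' h)
  have key : ∀ t₁ t₂, D.tree.Adj t₁ t₂ → ¬ IsLeaf D.tree t₁ → ¬ IsLeaf D.tree t₂ →
      Closed m (D.shore t₁ t₂) ∧ ∀ n, IsPM G n → crossing n (D.shore t₁ t₂) ≤ 2 := by
    intro t₁ t₂ hadj h1 h2
    obtain ⟨b, l, S, S', hl, hsub, hshore⟩ := hD t₁ t₂ hadj h1 h2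
    have hgood : Closed m (leaves (node S S')) ∧
        ∀ n, IsPM G n → crossing n (leaves (node S S')) ≤ 2 := by
      rcases sub_node_eq_some_iff.1 hsub with ⟨h, -⟩ | ⟨k, -, h⟩ | ⟨k, hk, h⟩
      · cases h
      · cases (sub_leaf_eq_some_iff.1 h).2
      · rcases sub_node_eq_some_iff.1 h with ⟨rfl, -⟩ | ⟨k', -, h⟩ | ⟨k', -, h⟩
        -- The address `[true]` belongs to the edge at the root, which is a leaf after pruning; the
        -- condition `l ≠ []` excludes it.
        · exact absurd (List.cons.inj hk).2 hl
        · cases (sub_leaf_eq_some_iff.1 h).2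
        · exact ht k' S S' h
    rcases hshore with h | h
    · rwa [h]
    · rw [← D.shore_compl hadj.symm, h]
      exact ⟨hgood.1.compl, fun n hn => (crossing_compl hn _).le.trans (hgood.2 n hn)⟩
  refine ⟨D, fun t₁ t₂ hadj h1 h2 => ?_, D.width_le_iff.2 fun t₁ t₂ hadj n hn => ?_⟩
  · rw [isConformal_iff hM hm, isConformal_iff hM hm]
    exact ⟨(key t₁ t₂ hadj h1 h2).1, (key t₂ t₁ hadj.symm h2 h1).1⟩
  · by_cases h1 : IsLeaf D.tree t₁
    · exact (crossing_le_card _ _).trans ((D.ncard_shore_le_one hadj h1).trans one_le_two)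
    by_cases h2 : IsLeaf D.tree t₂
    · rw [← D.shore_compl hadj.symm, crossing_compl hn]
      exact (crossing_le_card _ _).trans ((D.ncard_shore_le_one hadj.symm h2).trans one_le_two)
    · exact (key t₁ t₂ hadj h1 h2).2 n hn

end Construction

/-! ### The value of the `M`-perfect matching width -/

section Width

variable {V : Type u} {G : SimpleGraph V}

theorem HasHierarchy.nonempty {m : V → V} {X : Set V} (h : HasHierarchy G m X) : X.Nonempty := by
  induction h with
  | pair v => exact ⟨v, Or.inl rfl⟩
  | union _ _ _ _ h _ => exact h.inl

theorem mpmw_eq_two_of_forall_brace [Finite V] (hbip : G.IsBipartite) (hG : IsMatchingCovered G)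
    (hbr : ∀ (W : Type u) (H : SimpleGraph W), IsBraceOf H G →
        Nonempty (H ≃g SimpleGraph.cycleGraph 4) ∨
          Nonempty (H ≃g completeBipartiteGraph (Fin 3) (Fin 3)))
    {M : G.Subgraph} (hM : M.IsPerfectMatching) : mpmw G M = 2 := by
  obtain ⟨m, hm, hMm⟩ := exists_isPM_of_isPerfectMatching hM
  obtain ⟨r⟩ := hG.1.nonempty
  have h := hasHierarchy_of_forall_brace hbip hG hbr hm r
  -- A hierarchy is never on the empty set, so some matching edge lies outside `{r, m r}`. The
  -- single edge is thus excluded: it is a brace that is neither of the two allowed ones.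
  have h4 : 4 ≤ Nat.card V := by
    have h1 := Set.ncard_add_ncard_compl ({r, m r} : Set V)
    rw [Set.ncard_pair (hm r).1.ne] at h1
    have h2 := (Set.ncard_pos (Set.toFinite _)).2 h.nonempty
    obtain ⟨j, hj⟩ := (h.closed hm).even_ncard hm
    omega
  obtain ⟨D, hD, hw⟩ := h.exists_pmDecomposition hm hMm
  have hmin : mpmw G M ≤ D.width G := Nat.sInf_le ⟨D, hD, rfl⟩
  refine le_antisymm (hmin.trans hw) ?_
  refine le_csInf ?_ ?_
  · exact ⟨_, D, hD, rfl⟩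
  rintro _ ⟨D', -, rfl⟩
  exact D'.two_le_width hG h4

theorem nonempty_iso_of_mpmw_eq_two [Finite V] (hG : IsMatchingCovered G) {M : G.Subgraph}
    (hM : M.IsPerfectMatching) (h : mpmw G M = 2) {W : Type u} {H : SimpleGraph W}
    (hH : IsBraceOf H G) :
    Nonempty (H ≃g cycleGraph 4) ∨ Nonempty (H ≃g completeBipartiteGraph (Fin 3) (Fin 3)) := by
  obtain ⟨m, hm, hMm⟩ := exists_isPM_of_isPerfectMatching hM
  -- The infimum of the empty set is `0`, so the value `2` is attained by a decomposition.
  obtain ⟨D, hD, hw⟩ := Nat.sInf_mem (Nat.nonempty_of_sInf_eq_succ h)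
  change mpmw G M = _ at hw
  have h4 : 4 ≤ Nat.card V := by
    by_contra! hlt
    have := D.width_le_one (G := G) hlt
    omega
  exact nonempty_iso_of_splitsConformal hG h4 hm (D.splitsConformal hm hMm hD (by omega)) hH

end Width

end PMWidth

theorem mainTheorem6 {V : Type u} [Finite V] (G : SimpleGraph V)
    (hbip : G.IsBipartite) (hmc : PMWidth.IsMatchingCovered G)
    (hpm : ∃ M : G.Subgraph, M.IsPerfectMatching) :
    List.TFAE [
      ∃ M : G.Subgraph, M.IsPerfectMatching ∧ PMWidth.mpmw G M = 2,
      ∀ M : G.Subgraph, M.IsPerfectMatching → PMWidth.mpmw G M = 2,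
      ∀ (W : Type u) (H : SimpleGraph W), PMWidth.IsBraceOf H G →
        Nonempty (H ≃g SimpleGraph.cycleGraph 4) ∨
          Nonempty (H ≃g completeBipartiteGraph (Fin 3) (Fin 3))] := by
  tfae_have 1 → 3 := by
    rintro ⟨M, hM, h⟩ W H hH
    exact PMWidth.nonempty_iso_of_mpmw_eq_two hmc hM h hH
  tfae_have 3 → 2 := fun h M hM => PMWidth.mpmw_eq_two_of_forall_brace hbip hmc h hM
  tfae_have 2 → 1 := by
    obtain ⟨M, hM⟩ := hpm
    exact fun h => ⟨M, hM, h M hM⟩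
  tfae_finish
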